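/- There is an absolute constant $C>0$ such that for all integers $k\ge 2$ and $r\ge 2^{k^{C}}$, the maximum number of $\frac{1}{2k-1}$-equiangular lines in $\mathbb{R}^r$ equals $$r-1+\left\lfloor \frac{r-1}{k-1}\right\rfloor .$$ Here a family of lines through the origin in $\mathbb{R}^r$ is called $\alpha$-equiangular if the acute angle between any two distinct lines of the family equals $\arccos \alpha$. -/

import Mathlib

/-- The acute angle in `[0, π/2]` between two lines through the origin of a real inner product
space `V`: the smaller of the two angles that a pair of direction vectors and its switching
define. (`lineAngle_mk` shows that the choice of the direction vectors is irrelevant.) -/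
noncomputable def lineAngle {V : Type*} [NormedAddCommGroup V] [InnerProductSpace ℝ V]
    (l m : Projectivization ℝ V) : ℝ :=
  min (InnerProductGeometry.angle l.rep m.rep) (Real.pi - InnerProductGeometry.angle l.rep m.rep)

theorem lineAngle_mk {V : Type*} [NormedAddCommGroup V] [InnerProductSpace ℝ V]
    (u v : V) (hu : u ≠ 0) (hv : v ≠ 0) :
    lineAngle (Projectivization.mk ℝ u hu) (Projectivization.mk ℝ v hv) =
      min (InnerProductGeometry.angle u v) (Real.pi - InnerProductGeometry.angle u v) := by
  obtain ⟨a, ha⟩ := Projectivization.exists_smul_eq_mk_rep ℝ u hu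
  obtain ⟨b, hb⟩ := Projectivization.exists_smul_eq_mk_rep ℝ v hv
  unfold lineAngle
  rw [← ha, ← hb, Units.smul_def, Units.smul_def]
  rcases lt_or_gt_of_ne a.ne_zero with h | h <;> rcases lt_or_gt_of_ne b.ne_zero with h' | h' <;>
    simp [InnerProductGeometry.angle_smul_left_of_neg, InnerProductGeometry.angle_smul_left_of_pos,
      InnerProductGeometry.angle_smul_right_of_neg, InnerProductGeometry.angle_smul_right_of_pos,
      InnerProductGeometry.angle_neg_left, InnerProductGeometry.angle_neg_right, h, h', min_comm]

/-- A family of lines through the origin is `α`-equiangular if the acute angle between any two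
(distinct) lines of the family equals `arccos α`. -/
def IsEquiangular {V : Type*} [NormedAddCommGroup V] [InnerProductSpace ℝ V]
    (α : ℝ) (L : Set (Projectivization ℝ V)) : Prop :=
  L.Pairwise fun l m => lineAngle l m = Real.arccos α

/-!
Write `l = k - 1`. Choosing direction vectors of squared length `l + 1 / 2`, the lines become
vectors with inner products `± 1 / 2`, and their signs are recorded by the negative graph `G`, with
adjacency matrix `A`. The Gram matrix is `l - A + J / 2` with `J` the all-ones matrix, so
`A ≤ l + J / 2`, and more than `r - 1 + ⌊(r - 1) / l⌋` vectors in dimension `r` force many linear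
dependencies: with `N = r + ⌊(r - 1) / l⌋` vectors, the space of dependencies has dimension greater
than `N / (l + 1) - 1`.

*Bounded degree.* Ramsey's theorem gives a large set of mutually positive vectors. After switching
signs so that every vector is positive to at least half of this set, positivity of norms of suitable
combinations bounds all degrees of `G` by `2 ^ O(l ^ 2)` (`exists_switching`).

*Spectral radius at most `l`.* If `A ≤ l`, dependencies are `l`-eigenvectors of coordinate sum zero.
The eigenvalue `l` has multiplicity at most `N / (l + 1)`, and not all of its eigenvectors have
coordinate sum zero (`finrank_dependencySpace_of_form_le`).

*Spectral radius above `l`.* Two distant parts of `G` cannot both have spectral radius above `l`,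
since a combination of their top eigenvectors would violate `A ≤ l + J / 2`. So after isolating a
small set `U` of vertices, all balls of radius `p` have spectral radius at most `l`, and no clique
on `l + 1` vertices is left. Now the eigenvalue `l` has multiplicity at most about `N / (l + 2)`
(`finrank_dependencySpace_of_large`), which is a contradiction if `N` is large.

*Multiplicity.* Both bounds come from `finrank_eigenspace_le`. The trace of `(A + l) ^ p` counts
closed lazy walks and is at least `(2 * l) ^ p` times the multiplicity of `l`. By interlacing,
deleting a vertex lowers the trace by at most `(2 * l) ^ p`, provided that the ball around the
vertex has spectral radius at most `l`; hence the closed walks through a vertex have total weight at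
most `(2 * l) ^ p`. If all but a negligible part of the walks visit more than `h` vertices, double
counting pairs of a walk and a vertex on it bounds the multiplicity by about `N / (h + 1)`. Walks
that visit at most `h` vertices are negligible, since sets of `h` vertices have spectral radius
bounded away from `l` and only few such sets are within reach of a given starting point. As the walk
length `p` may be polynomial in `l`, balls of radius `p` have size `2 ^ poly(l)`, which is where the
condition on `r` comes from.

The bound is attained by `⌊(r - 1) / l⌋` regular simplices with `l + 1` vertices in orthogonal
spaces of dimension `l`, together with orthogonal single vectors, all lifted by a common vector
(`simplexFamily`).
-/

/-! ### Eigenvalue counting and traces of powers -/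

section Spectral

variable {n : Type*} [Fintype n] [DecidableEq n] {M M' : Matrix n n ℝ}

open Matrix Module

theorem Matrix.IsHermitian.dotProduct_mulVec_eq_sum (hM : M.IsHermitian)
    (x : EuclideanSpace ℝ n) :
    x.ofLp ⬝ᵥ M *ᵥ x.ofLp = ∑ j, hM.eigenvalues j * hM.eigenvectorBasis.repr x j ^ 2 := by
  set b := hM.eigenvectorBasis with hb
  have hx : x.ofLp = ∑ j, b.repr x j • (b j).ofLp := by
    conv_lhs => rw [← b.sum_repr x]
    simp
  have hMx : M *ᵥ x.ofLp = ∑ j, (b.repr x j * hM.eigenvalues j) • (b j).ofLp := by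
    conv_lhs => rw [hx]
    rw [mulVec_sum]
    refine Finset.sum_congr rfl fun j _ => ?_
    rw [mulVec_smul, hM.mulVec_eigenvectorBasis, smul_smul]
  rw [hMx, dotProduct_sum]
  refine Finset.sum_congr rfl fun j _ => ?_
  have : b.repr x j = x.ofLp ⬝ᵥ (b j).ofLp := by
    rw [b.repr_apply_apply, EuclideanSpace.inner_eq_star_dotProduct]
    simp
  rw [dotProduct_smul, ← this, smul_eq_mul]
  ring

theorem Matrix.IsHermitian.dotProduct_self_eq_sum (hM : M.IsHermitian)
    (x : EuclideanSpace ℝ n) :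
    x.ofLp ⬝ᵥ x.ofLp = ∑ j, hM.eigenvectorBasis.repr x j ^ 2 := by
  have h1 : x.ofLp ⬝ᵥ x.ofLp = ‖x‖ ^ 2 := by
    rw [EuclideanSpace.real_norm_sq_eq, dotProduct]
    exact Finset.sum_congr rfl fun i _ => (sq _).symm
  rw [h1, ← hM.eigenvectorBasis.repr.norm_map x, EuclideanSpace.real_norm_sq_eq]

/-- A subspace on which the form of `M` is at least `c` forces as many eigenvalues `≥ c`. -/
theorem Matrix.IsHermitian.finrank_le_card_eigenvalues (hM : M.IsHermitian) (c : ℝ)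
    (Y : Submodule ℝ (EuclideanSpace ℝ n))
    (hY : ∀ x ∈ Y, c * (x.ofLp ⬝ᵥ x.ofLp) ≤ x.ofLp ⬝ᵥ M *ᵥ x.ofLp) :
    finrank ℝ Y ≤ Fintype.card {j // c ≤ hM.eigenvalues j} := by
  let φ : Y →ₗ[ℝ] ({j // c ≤ hM.eigenvalues j} → ℝ) :=
    { toFun := fun x j => hM.eigenvectorBasis.repr x.1 j.1
      map_add' := fun x y => by ext; simp
      map_smul' := fun a x => by ext; simp }
  have hφ : Function.Injective φ := by
    rw [injective_iff_map_eq_zero]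
    rintro ⟨x, hx⟩ h0
    have h0' : ∀ j, c ≤ hM.eigenvalues j → hM.eigenvectorBasis.repr x j = 0 :=
      fun j hj => congrFun h0 ⟨j, hj⟩
    have h1 := hY x hx
    rw [hM.dotProduct_mulVec_eq_sum, hM.dotProduct_self_eq_sum, Finset.mul_sum] at h1
    have h2 : ∀ j ∈ Finset.univ, hM.eigenvalues j * hM.eigenvectorBasis.repr x j ^ 2 ≤
        c * hM.eigenvectorBasis.repr x j ^ 2 := by
      intro j _
      by_cases hj : c ≤ hM.eigenvalues j
      · simp [h0' j hj]
      · exact mul_le_mul_of_nonneg_right (not_le.1 hj).le (sq_nonneg _)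
    have h3 := (Finset.sum_eq_sum_iff_of_le h2).1 (le_antisymm (Finset.sum_le_sum h2) h1)
    have h4 : hM.eigenvectorBasis.repr x = 0 := by
      ext j
      by_cases hj : c ≤ hM.eigenvalues j
      · exact h0' j hj
      · have h5 := h3 j (Finset.mem_univ _)
        by_contra h6
        exact (not_le.1 hj).ne (mul_right_cancel₀ (pow_ne_zero 2 h6) h5)
    have h5 : x = 0 := by simpa using h4
    simpa using h5
  simpa using LinearMap.finrank_le_finrank_of_injective hφ

/-- Cauchy interlacing, in counting form: if the quadratic forms of `M` and `M'` agree on the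
hyperplane `x i = 0`, then passing from `M` to `M'` loses at most one of the eigenvalues `≥ c`. -/
theorem Matrix.IsHermitian.card_eigenvalues_le_add_one (hM : M.IsHermitian)
    (hM' : M'.IsHermitian) (i : n)
    (h : ∀ x : n → ℝ, x i = 0 → x ⬝ᵥ M' *ᵥ x = x ⬝ᵥ M *ᵥ x) (c : ℝ) :
    Fintype.card {j // c ≤ hM.eigenvalues j} ≤
      Fintype.card {j // c ≤ hM'.eigenvalues j} + 1 := by
  let φ : EuclideanSpace ℝ n →ₗ[ℝ] ({j // ¬ c ≤ hM.eigenvalues j} → ℝ) × ℝ :=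
    { toFun := fun x => (fun j => hM.eigenvectorBasis.repr x j.1, x.ofLp i)
      map_add' := fun x y => by ext <;> simp
      map_smul' := fun a x => by ext <;> simp }
  have hker : ∀ x ∈ LinearMap.ker φ,
      c * (x.ofLp ⬝ᵥ x.ofLp) ≤ x.ofLp ⬝ᵥ M' *ᵥ x.ofLp := by
    intro x hx
    have hx' := LinearMap.mem_ker.1 hx
    have hxi : x.ofLp i = 0 := congrArg Prod.snd hx'
    have hxj : ∀ j, ¬ c ≤ hM.eigenvalues j → hM.eigenvectorBasis.repr x j = 0 :=
      fun j hj => congrFun (congrArg Prod.fst hx') ⟨j, hj⟩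
    rw [h _ hxi, hM.dotProduct_mulVec_eq_sum, hM.dotProduct_self_eq_sum, Finset.mul_sum]
    refine Finset.sum_le_sum fun j _ => ?_
    by_cases hj : c ≤ hM.eigenvalues j
    · exact mul_le_mul_of_nonneg_right hj (sq_nonneg _)
    · simp [hxj j hj]
  have h1 := hM'.finrank_le_card_eigenvalues c _ hker
  have h2 := LinearMap.finrank_range_add_finrank_ker φ
  have h3 : finrank ℝ (LinearMap.range φ) ≤
      Fintype.card {j // ¬ c ≤ hM.eigenvalues j} + 1 := by
    refine (Submodule.finrank_le _).trans ?_
    simp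
  rw [finrank_euclideanSpace] at h2
  have h4 := Fintype.card_subtype_compl (fun j => c ≤ hM.eigenvalues j)
  have h5 := Fintype.card_subtype_le (fun j => c ≤ hM.eigenvalues j)
  omega

theorem Matrix.IsHermitian.eigenvalues_reindex (hM : M.IsHermitian)
    (j : Fin (Fintype.card n)) :
    hM.eigenvalues (Fintype.equivOfCardEq (Fintype.card_fin _) j) = hM.eigenvalues₀ j := by
  simp [Matrix.IsHermitian.eigenvalues]

theorem Matrix.IsHermitian.card_eigenvalues_eq (hM : M.IsHermitian) (c : ℝ) :
    Fintype.card {j // c ≤ hM.eigenvalues j} = Fintype.card {j // c ≤ hM.eigenvalues₀ j} :=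
  Fintype.card_congr ((Equiv.subtypeEquiv (Fintype.equivOfCardEq (Fintype.card_fin _))
    (fun j => by rw [hM.eigenvalues_reindex])).symm)

theorem Matrix.IsHermitian.trace_pow_eq_sum (hM : M.IsHermitian) (p : ℕ) :
    (M ^ p).trace = ∑ j, hM.eigenvalues j ^ p := by
  have h := hM.spectral_theorem
  set U := hM.eigenvectorUnitary
  have h2 : M ^ p = Unitary.conjStarAlgAut ℝ _ U (diagonal (hM.eigenvalues) ^ p) := by
    rw [map_pow]
    congr 1
  rw [h2, Unitary.conjStarAlgAut_apply, trace_mul_comm, ← mul_assoc]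
  simp [diagonal_pow, trace]

theorem Matrix.IsHermitian.trace_pow_eq_sum_eigenvalues₀ (hM : M.IsHermitian) (p : ℕ) :
    (M ^ p).trace = ∑ j, hM.eigenvalues₀ j ^ p := by
  rw [hM.trace_pow_eq_sum, ← Equiv.sum_comp (Fintype.equivOfCardEq (Fintype.card_fin _))]
  exact Finset.sum_congr rfl fun j _ => by rw [hM.eigenvalues_reindex]

theorem Matrix.IsHermitian.eigenvalues_eq_quad (hM : M.IsHermitian) (j : n) :
    ∃ x : n → ℝ, x ⬝ᵥ x = 1 ∧ hM.eigenvalues j = x ⬝ᵥ M *ᵥ x := by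
  refine ⟨(hM.eigenvectorBasis j).ofLp, ?_, ?_⟩
  · rw [hM.dotProduct_self_eq_sum]
    simp
  · rw [hM.mulVec_eigenvectorBasis, dotProduct_smul, hM.dotProduct_self_eq_sum]
    simp

theorem Matrix.IsHermitian.eigenvalues₀_eq_quad (hM : M.IsHermitian) (j) :
    ∃ x : n → ℝ, x ⬝ᵥ x = 1 ∧ hM.eigenvalues₀ j = x ⬝ᵥ M *ᵥ x := by
  rw [← hM.eigenvalues_reindex]
  exact hM.eigenvalues_eq_quad _

/-- Deleting one row and column from a positive semidefinite matrix `M ≤ c` lowers the trace of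
the `p`-th power by at most `c ^ p`: the eigenvalues interlace, so the loss telescopes. -/
theorem Matrix.IsHermitian.trace_pow_le_trace_pow_add (hM : M.IsHermitian)
    (hM' : M'.IsHermitian) (i : n)
    (h : ∀ x : n → ℝ, x i = 0 → x ⬝ᵥ M' *ᵥ x = x ⬝ᵥ M *ᵥ x) (c : ℝ)
    (h0 : ∀ x, 0 ≤ x ⬝ᵥ M *ᵥ x) (h0' : ∀ x, 0 ≤ x ⬝ᵥ M' *ᵥ x)
    (hc : ∀ x, x ⬝ᵥ M *ᵥ x ≤ c * (x ⬝ᵥ x)) (p : ℕ) :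
    (M ^ p).trace ≤ (M' ^ p).trace + c ^ p := by
  rw [hM.trace_pow_eq_sum_eigenvalues₀, hM'.trace_pow_eq_sum_eigenvalues₀]
  have hpos : ∀ j, 0 ≤ hM.eigenvalues₀ j := fun j => by
    obtain ⟨x, -, hx⟩ := hM.eigenvalues₀_eq_quad j
    rw [hx]; exact h0 x
  have hpos' : ∀ j, 0 ≤ hM'.eigenvalues₀ j := fun j => by
    obtain ⟨x, -, hx⟩ := hM'.eigenvalues₀_eq_quad j
    rw [hx]; exact h0' x
  have hle : ∀ j, hM.eigenvalues₀ j ≤ c := fun j => by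
    obtain ⟨x, hx1, hx⟩ := hM.eigenvalues₀_eq_quad j
    rw [hx]; simpa [hx1] using hc x
  have hanti := hM.eigenvalues₀_antitone
  have hanti' := hM'.eigenvalues₀_antitone
  have hcount : ∀ t : ℝ, Fintype.card {j // t ≤ hM.eigenvalues₀ j} ≤
      Fintype.card {j // t ≤ hM'.eigenvalues₀ j} + 1 := fun t => by
    rw [← hM.card_eigenvalues_eq, ← hM'.card_eigenvalues_eq]
    exact hM.card_eigenvalues_le_add_one hM' i h t
  generalize hM.eigenvalues₀ = μ at *
  generalize hM'.eigenvalues₀ = ν at *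
  have hn : 0 < Fintype.card n := Fintype.card_pos_iff.2 ⟨i⟩
  obtain ⟨m, hm⟩ : ∃ m, Fintype.card n = m + 1 := ⟨Fintype.card n - 1, by omega⟩
  generalize Fintype.card n = N at *
  subst hm
  have hinter : ∀ j : Fin m, μ j.succ ≤ ν j.castSucc := by
    intro j
    by_contra hlt
    push Not at hlt
    have h1 : (j : ℕ) + 2 ≤ Fintype.card {l // μ j.succ ≤ μ l} := by
      rw [Fintype.card_subtype]
      have : Finset.Iic j.succ ⊆ Finset.univ.filter fun l => μ j.succ ≤ μ l := by
        intro l hl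
        simpa using hanti (Finset.mem_Iic.1 hl)
      have h3 := Finset.card_le_card this
      rwa [Fin.card_Iic, Fin.val_succ] at h3
    have h2 : Fintype.card {l // μ j.succ ≤ ν l} ≤ j := by
      rw [Fintype.card_subtype]
      have : (Finset.univ.filter fun l => μ j.succ ≤ ν l) ⊆ Finset.Iio j.castSucc := by
        intro l hl
        rw [Finset.mem_Iio]
        by_contra hl'
        have := hanti' (not_lt.1 hl')
        have h3 := (Finset.mem_filter.1 hl).2
        linarith
      simpa using Finset.card_le_card this
    have := hcount (μ j.succ)
    omega
  rw [Fin.sum_univ_succ, Fin.sum_univ_castSucc]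
  have h1 : ∑ j : Fin m, μ j.succ ^ p ≤ ∑ j : Fin m, ν j.castSucc ^ p :=
    Finset.sum_le_sum fun j _ => pow_le_pow_left₀ (hpos _) (hinter j) p
  have h2 : μ 0 ^ p ≤ c ^ p := pow_le_pow_left₀ (hpos _) (hle _) p
  have h3 := pow_nonneg (hpos' (Fin.last m)) p
  linarith

/-- A subspace on which the form of `M` is at least `c` contributes its dimension times `c ^ p`
to an even trace moment. -/
theorem Matrix.IsHermitian.finrank_mul_pow_le_trace_pow (hM : M.IsHermitian) {c : ℝ} (hc : 0 ≤ c)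
    (Y : Submodule ℝ (EuclideanSpace ℝ n))
    (hY : ∀ x ∈ Y, c * (x.ofLp ⬝ᵥ x.ofLp) ≤ x.ofLp ⬝ᵥ M *ᵥ x.ofLp) {p : ℕ} (hp : Even p) :
    finrank ℝ Y * c ^ p ≤ (M ^ p).trace := by
  rw [hM.trace_pow_eq_sum]
  have h1 := hM.finrank_le_card_eigenvalues c Y hY
  rw [Fintype.card_subtype] at h1
  calc (finrank ℝ Y : ℝ) * c ^ p
      ≤ (Finset.univ.filter fun j => c ≤ hM.eigenvalues j).card * c ^ p := by
        gcongr
    _ = ∑ j ∈ Finset.univ.filter fun j => c ≤ hM.eigenvalues j, c ^ p := by simp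
    _ ≤ ∑ j ∈ Finset.univ.filter fun j => c ≤ hM.eigenvalues j, hM.eigenvalues j ^ p :=
        Finset.sum_le_sum fun j hj => pow_le_pow_left₀ hc (Finset.mem_filter.1 hj).2 p
    _ ≤ ∑ j, hM.eigenvalues j ^ p :=
        Finset.sum_le_sum_of_subset_of_nonneg (Finset.filter_subset _ _)
          fun j _ _ => hp.pow_nonneg _

/-- A subset `F` carries at most `#F` nonzero eigenvalues. -/
theorem Matrix.IsHermitian.trace_pow_le_card_mul (hM : M.IsHermitian) (F : Finset n) {c : ℝ}
    (hF : ∀ i ∉ F, ∀ j, M i j = 0) (h0 : ∀ x, 0 ≤ x ⬝ᵥ M *ᵥ x)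
    (hc : ∀ x, x ⬝ᵥ M *ᵥ x ≤ c * (x ⬝ᵥ x)) {p : ℕ} (hp : p ≠ 0) :
    (M ^ p).trace ≤ F.card * c ^ p := by
  have h1 : ∀ x : n → ℝ, x ⬝ᵥ x = 1 → ∀ t, t = x ⬝ᵥ M *ᵥ x → 0 ≤ t ∧ t ≤ c := by
    intro x hx t ht
    exact ⟨ht ▸ h0 x, by simpa [ht, hx] using hc x⟩
  have h2 : ∀ j, 0 ≤ hM.eigenvalues j ∧ hM.eigenvalues j ≤ c := fun j => by
    obtain ⟨x, hx, h⟩ := hM.eigenvalues_eq_quad j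
    exact h1 x hx _ h
  have hcard : (Finset.univ.filter fun j => hM.eigenvalues j ≠ 0).card ≤ F.card := by
    rw [← Fintype.card_subtype, ← hM.rank_eq_card_non_zero_eigs]
    have hr : M = (diagonal fun i => if i ∈ F then (1 : ℝ) else 0) * M := by
      ext i j
      rw [diagonal_mul]
      by_cases hi : i ∈ F
      · simp [hi]
      · simp [hi, hF i hi j]
    rw [hr]
    refine (rank_mul_le_left _ _).trans ?_
    rw [rank_diagonal]
    simp
  rw [hM.trace_pow_eq_sum]
  calc ∑ j, hM.eigenvalues j ^ p
      = ∑ j ∈ Finset.univ.filter fun j => hM.eigenvalues j ≠ 0, hM.eigenvalues j ^ p := by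
        rw [Finset.sum_filter]
        refine Finset.sum_congr rfl fun j _ => ?_
        by_cases h : hM.eigenvalues j = 0 <;> simp [h, hp]
    _ ≤ ∑ j ∈ Finset.univ.filter fun j => hM.eigenvalues j ≠ 0, c ^ p :=
        Finset.sum_le_sum fun j _ => pow_le_pow_left₀ (h2 j).1 (h2 j).2 p
    _ = (Finset.univ.filter fun j => hM.eigenvalues j ≠ 0).card * c ^ p := by simp
    _ ≤ F.card * c ^ p := by
        rcases Finset.eq_empty_or_nonempty
          (Finset.univ.filter fun j => hM.eigenvalues j ≠ 0) with h | ⟨j, -⟩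
        · rw [h]
          by_cases hFe : F.card = 0
          · simp [hFe]
          · obtain ⟨i, -⟩ := Finset.card_pos.1 (Nat.pos_of_ne_zero hFe)
            have := (h2 i).1.trans (h2 i).2
            simp only [Finset.card_empty, Nat.cast_zero, zero_mul]
            positivity
        · have := (h2 j).1.trans (h2 j).2
          gcongr

end Spectral

/-! ### Weighted walks and trace moments -/

section Walks

variable {V : Type*}

open Matrix

/-- The weight of the walk `w 0, …, w p`: the product of the entries of `M` along its steps. -/
def walkWeight (M : Matrix V V ℝ) {p : ℕ} (w : Fin (p + 1) → V) : ℝ :=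
  ∏ t : Fin p, M (w t.castSucc) (w t.succ)

/-- The weight of a closed walk, with the value `0` if the walk is not closed. -/
def closedWeight [DecidableEq V] (M : Matrix V V ℝ) {p : ℕ} (w : Fin (p + 1) → V) : ℝ :=
  if w 0 = w (Fin.last p) then walkWeight M w else 0

theorem pow_apply_eq_sum_walkWeight [Fintype V] [DecidableEq V] (M : Matrix V V ℝ) (p : ℕ)
    (a b : V) : (M ^ p) a b = ∑ w : Fin (p + 1) → V,
      if w 0 = a ∧ w (Fin.last p) = b then walkWeight M w else 0 := by
  induction p generalizing a with
  | zero =>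
    rw [← Equiv.sum_comp (Equiv.funUnique (Fin 1) V).symm]
    rw [pow_zero, one_apply]
    simp only [walkWeight, Finset.univ_eq_empty, Finset.prod_empty]
    by_cases hab : a = b
    · subst hab; simp
    · rw [if_neg hab, eq_comm]
      refine Finset.sum_eq_zero fun c _ => if_neg ?_
      rintro ⟨h1, h2⟩
      exact hab (h1.symm.trans h2)
  | succ p ih =>
    rw [pow_succ', mul_apply, ← Equiv.sum_comp (Fin.consEquiv fun _ => V), Fintype.sum_prod_type]
    have h1 : ∀ c : V, ∀ w : Fin (p + 1) → V,
        (if (Fin.consEquiv fun _ => V) (c, w) 0 = a ∧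
            (Fin.consEquiv fun _ => V) (c, w) (Fin.last (p + 1)) = b then
          walkWeight M ((Fin.consEquiv fun _ => V) (c, w)) else 0) =
        if c = a then (if w (Fin.last p) = b then M c (w 0) * walkWeight M w else 0) else 0 := by
      intro c w
      have h2 : walkWeight M (Fin.cons c w : Fin (p + 2) → V) = M c (w 0) * walkWeight M w := by
        rw [walkWeight, Fin.prod_univ_succ]
        rfl
      have h3 : (Fin.cons c w : Fin (p + 2) → V) (Fin.last (p + 1)) = w (Fin.last p) := by
        rw [← Fin.succ_last, Fin.cons_succ]
      have h4 : (Fin.consEquiv fun _ => V) (c, w) = (Fin.cons c w : Fin (p + 2) → V) := rfl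
      rw [h4, h2, h3, Fin.cons_zero]
      by_cases h5 : c = a <;> simp [h5]
    simp_rw [h1]
    refine Eq.trans ?_ (Finset.sum_eq_single a (fun c _ hc => by simp [hc]) (by simp)).symm
    simp_rw [ih, Finset.mul_sum]
    rw [Finset.sum_comm]
    refine Finset.sum_congr rfl fun w _ => ?_
    refine (Finset.sum_eq_single (w 0) (fun c _ hc => by simp [hc.symm]) (by simp)).trans ?_
    simp

theorem trace_pow_eq_sum_closedWeight [Fintype V] [DecidableEq V] (M : Matrix V V ℝ) (p : ℕ) :
    (M ^ p).trace = ∑ w : Fin (p + 1) → V, closedWeight M w := by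
  simp only [trace, diag_apply, pow_apply_eq_sum_walkWeight]
  rw [Finset.sum_comm]
  refine Finset.sum_congr rfl fun w _ => ?_
  rw [Finset.sum_eq_single (w 0) (fun c _ hc => by simp [hc.symm]) (by simp)]
  simp [closedWeight, eq_comm]

/-- The compression of `M` to the coordinates in `F`, kept as a matrix on `V`. -/
def restrictMatrix [DecidableEq V] (F : Finset V) (M : Matrix V V ℝ) : Matrix V V ℝ :=
  Matrix.of fun i j => if i ∈ F ∧ j ∈ F then M i j else 0

theorem walkWeight_restrictMatrix [DecidableEq V] (F : Finset V) (M : Matrix V V ℝ) {p : ℕ}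
    (hp : p ≠ 0) (w : Fin (p + 1) → V) :
    walkWeight (restrictMatrix F M) w = if ∀ t, w t ∈ F then walkWeight M w else 0 := by
  split_ifs with h
  · exact Finset.prod_congr rfl fun t _ => by simp [restrictMatrix, h]
  · push Not at h
    obtain ⟨t, ht⟩ := h
    obtain ⟨q, rfl⟩ := Nat.exists_eq_succ_of_ne_zero hp
    refine Fin.cases (fun ht => ?_) (fun s ht => ?_) t ht
    · exact Finset.prod_eq_zero (Finset.mem_univ 0) (by simp [restrictMatrix, ht])
    · exact Finset.prod_eq_zero (Finset.mem_univ s) (by simp [restrictMatrix, ht])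

theorem trace_restrictMatrix_pow [Fintype V] [DecidableEq V] (F : Finset V)
    (M : Matrix V V ℝ) {p : ℕ} (hp : p ≠ 0) :
    (restrictMatrix F M ^ p).trace =
      ∑ w : Fin (p + 1) → V, if ∀ t, w t ∈ F then closedWeight M w else 0 := by
  rw [trace_pow_eq_sum_closedWeight]
  refine Finset.sum_congr rfl fun w _ => ?_
  simp only [closedWeight, walkWeight_restrictMatrix F M hp]
  split_ifs <;> rfl

theorem isHermitian_restrictMatrix [DecidableEq V] (F : Finset V) {M : Matrix V V ℝ}
    (hM : M.IsHermitian) :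
    (restrictMatrix F M).IsHermitian := by
  ext i j
  have h := hM.apply i j
  simp only [star_trivial] at h
  simp [restrictMatrix, and_comm, h]

theorem dotProduct_restrictMatrix [Fintype V] [DecidableEq V] (F : Finset V)
    (M : Matrix V V ℝ) (x : V → ℝ) :
    x ⬝ᵥ restrictMatrix F M *ᵥ x =
      (fun i => if i ∈ F then x i else 0) ⬝ᵥ M *ᵥ (fun i => if i ∈ F then x i else 0) := by
  simp only [dotProduct, mulVec, restrictMatrix, Matrix.of_apply, Finset.mul_sum]
  refine Finset.sum_congr rfl fun i _ => Finset.sum_congr rfl fun j _ => ?_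
  by_cases hi : i ∈ F <;> by_cases hj : j ∈ F <;> simp [hi, hj]

theorem closedWeight_nonneg [DecidableEq V] {M : Matrix V V ℝ} (hM : ∀ i j, 0 ≤ M i j) {p : ℕ}
    (w : Fin (p + 1) → V) : 0 ≤ closedWeight M w := by
  unfold closedWeight walkWeight
  split_ifs
  · exact Finset.prod_nonneg fun t _ => hM _ _
  · exact le_rfl

theorem step_ne_zero_of_closedWeight_ne_zero [DecidableEq V] {M : Matrix V V ℝ} {p : ℕ}
    {w : Fin (p + 1) → V}
    (hw : closedWeight M w ≠ 0) (t : Fin p) : M (w t.castSucc) (w t.succ) ≠ 0 := by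
  unfold closedWeight at hw
  split_ifs at hw
  · exact Finset.prod_ne_zero_iff.1 hw t (Finset.mem_univ t)
  · exact absurd rfl hw

end Walks

/-! ### Balls in graphs -/

section Balls

variable {V : Type*}

/-- The vertices at distance at most `t` from `v`. -/
noncomputable def SimpleGraph.ballFinset [Fintype V] (G : SimpleGraph V) (t : ℕ) (v : V) :
    Finset V :=
  open Classical in Finset.univ.filter fun u => G.edist v u ≤ t

theorem SimpleGraph.mem_ballFinset [Fintype V] {G : SimpleGraph V} {t : ℕ} {u v : V} :
    u ∈ G.ballFinset t v ↔ G.edist v u ≤ t := by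
  simp [SimpleGraph.ballFinset]

theorem SimpleGraph.card_ballFinset_le [Fintype V] [DecidableEq V] (G : SimpleGraph V)
    [DecidableRel G.Adj] {D : ℕ} (hD : ∀ v, G.degree v ≤ D) (t : ℕ) (v : V) :
    (G.ballFinset t v).card ≤ (D + 1) ^ t := by
  induction t with
  | zero =>
    have : G.ballFinset 0 v ⊆ {v} := fun u hu => by
      have h0 : G.edist v u = 0 := by simpa [SimpleGraph.mem_ballFinset] using hu
      exact Finset.mem_singleton.2 (SimpleGraph.edist_eq_zero_iff.1 h0).symm
    simpa using Finset.card_le_card this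
  | succ t ih =>
    have h1 : G.ballFinset (t + 1) v ⊆
        (G.ballFinset t v).biUnion fun u => insert u (G.neighborFinset u) := by
      intro u hu
      rw [SimpleGraph.mem_ballFinset, SimpleGraph.edist_comm] at hu
      have hne : G.edist u v ≠ ⊤ := ne_top_of_le_ne_top (ENat.natCast_ne_top _) hu
      obtain ⟨W, hW⟩ := SimpleGraph.exists_walk_of_edist_ne_top hne
      rw [← hW] at hu
      have hu' : W.length ≤ t + 1 := by exact_mod_cast hu
      rw [Finset.mem_biUnion]
      cases W with
      | nil => exact ⟨v, by simp [SimpleGraph.mem_ballFinset], by simp⟩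
      | @cons _ u' _ hadj W' =>
        refine ⟨u', ?_, ?_⟩
        · rw [SimpleGraph.mem_ballFinset, SimpleGraph.edist_comm]
          refine (SimpleGraph.edist_le W').trans ?_
          have : W'.length ≤ t := by simpa using hu'
          exact_mod_cast this
        · simp [hadj.symm]
    have h2 := Finset.card_biUnion_le_card_mul (G.ballFinset t v)
      (fun u => insert u (G.neighborFinset u)) (D + 1) fun u _ =>
        (Finset.card_insert_le _ _).trans (Nat.succ_le_succ (hD u))
    calc _ ≤ _ := Finset.card_le_card h1
      _ ≤ _ := h2
      _ ≤ (D + 1) ^ t * (D + 1) := Nat.mul_le_mul_right _ ih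
      _ = _ := (pow_succ _ _).symm

theorem SimpleGraph.edist_le_of_steps (G : SimpleGraph V) {g : ℕ → V} {p : ℕ}
    (hg : ∀ t < p, G.edist (g t) (g (t + 1)) ≤ 1) (s d : ℕ) (hsd : s + d ≤ p) :
    G.edist (g s) (g (s + d)) ≤ d := by
  induction d with
  | zero => simp
  | succ d ih =>
    calc G.edist (g s) (g (s + d + 1)) ≤ G.edist (g s) (g (s + d)) +
          G.edist (g (s + d)) (g (s + d + 1)) := SimpleGraph.edist_triangle
      _ ≤ d + 1 := add_le_add (ih (by omega)) (hg _ (by omega))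
      _ = _ := by push_cast; rfl

/-- A lazy walk stays within distance `h` of its start, `h` being the number of vertices it
visits. -/
theorem SimpleGraph.edist_le_card_image [DecidableEq V] (G : SimpleGraph V) {g : ℕ → V} {p : ℕ}
    (hg : ∀ t < p, G.edist (g t) (g (t + 1)) ≤ 1) (t : ℕ) (ht : t ≤ p) :
    ∀ s ≤ t, G.edist (g 0) (g s) ≤ ((Finset.range (t + 1)).image g).card := by
  induction t with
  | zero => intro s hs; obtain rfl : s = 0 := by omega
            simp
  | succ t ih =>
    intro s hs
    have hsub : (Finset.range (t + 1)).image g ⊆ (Finset.range (t + 1 + 1)).image g :=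
      Finset.image_subset_image (Finset.range_subset_range.2 (by omega))
    have hmono : (((Finset.range (t + 1)).image g).card : ℕ∞) ≤
        ((Finset.range (t + 1 + 1)).image g).card := by
      exact_mod_cast Finset.card_le_card hsub
    rcases Nat.lt_or_ge s (t + 1) with h | h
    · exact (ih (by omega) s (by omega)).trans hmono
    · obtain rfl : s = t + 1 := by omega
      by_cases hmem : g (t + 1) ∈ (Finset.range (t + 1)).image g
      · obtain ⟨s', hs', hs''⟩ := Finset.mem_image.1 hmem
        rw [← hs'']
        exact (ih (by omega) s' (by have := Finset.mem_range.1 hs'; omega)).trans hmono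
      · rw [Finset.range_add_one, Finset.image_insert, Finset.card_insert_of_notMem hmem]
        calc G.edist (g 0) (g (t + 1)) ≤ G.edist (g 0) (g t) + G.edist (g t) (g (t + 1)) :=
              SimpleGraph.edist_triangle
          _ ≤ ((Finset.range (t + 1)).image g).card + 1 :=
              add_le_add (ih (by omega) t le_rfl) (hg t (by omega))
          _ = _ := by push_cast; rfl

end Balls

/-! ### Local spectral bounds control eigenvalue multiplicity -/

section Multiplicity

variable {V : Type*} [Fintype V] [DecidableEq V]

open Matrix Module

omit [DecidableEq V] in
theorem adjMatrix_form_abs (G : SimpleGraph V) [DecidableRel G.Adj] (x : V → ℝ) :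
    |x ⬝ᵥ G.adjMatrix ℝ *ᵥ x| ≤ |x| ⬝ᵥ G.adjMatrix ℝ *ᵥ |x| := by
  simp only [dotProduct, mulVec, Finset.mul_sum, Pi.abs_apply]
  refine (Finset.abs_sum_le_sum_abs _ _).trans (Finset.sum_le_sum fun i _ => ?_)
  refine (Finset.abs_sum_le_sum_abs _ _).trans (Finset.sum_le_sum fun j _ => ?_)
  rw [abs_mul, abs_mul]
  have : |G.adjMatrix ℝ i j| = G.adjMatrix ℝ i j := by
    rw [SimpleGraph.adjMatrix_apply]; split_ifs <;> simp
  rw [this]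

omit [DecidableEq V] in
theorem dotProduct_abs_self (x : V → ℝ) : |x| ⬝ᵥ |x| = x ⬝ᵥ x := by
  simp [dotProduct]

/-- The matrix `A + lam` of a graph, whose powers count lazy walks. -/
noncomputable def lazyMatrix (G : SimpleGraph V) [DecidableRel G.Adj] (lam : ℝ) : Matrix V V ℝ :=
  G.adjMatrix ℝ + lam • 1

section

variable (G : SimpleGraph V) [DecidableRel G.Adj] (lam : ℝ)

theorem lazyMatrix_form (x : V → ℝ) :
    x ⬝ᵥ lazyMatrix G lam *ᵥ x = x ⬝ᵥ G.adjMatrix ℝ *ᵥ x + lam * (x ⬝ᵥ x) := by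
  simp [lazyMatrix, add_mulVec, smul_mulVec, dotProduct_add]

omit [Fintype V] in
theorem isHermitian_lazyMatrix : (lazyMatrix G lam).IsHermitian := by
  ext i j
  simp [lazyMatrix, SimpleGraph.adjMatrix_apply, Matrix.one_apply, SimpleGraph.adj_comm, eq_comm]

variable {G lam}

omit [Fintype V] in
theorem lazyMatrix_nonneg (hlam : 0 ≤ lam) (i j : V) : 0 ≤ lazyMatrix G lam i j := by
  simp only [lazyMatrix, Matrix.add_apply, SimpleGraph.adjMatrix_apply, Matrix.smul_apply,
    one_apply, smul_eq_mul]
  split_ifs <;> simp <;> linarith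

omit [Fintype V] in
theorem edist_le_one_of_lazyMatrix_ne_zero {i j : V} (h : lazyMatrix G lam i j ≠ 0) :
    G.edist i j ≤ 1 := by
  by_cases hij : i = j
  · simp [hij]
  · by_cases hadj : G.Adj i j
    · exact (SimpleGraph.edist_eq_one_iff_adj.2 hadj).le
    · simp [lazyMatrix, SimpleGraph.adjMatrix_apply, hij, hadj] at h

/-- If the adjacency form is at most `c` on `F`, the compression of `A + lam` to `F` is positive
semidefinite and at most `lam + c`; negative eigenvalues of `A` are controlled by passing to
absolute values. -/
theorem lazyMatrix_restrict_bounds {F : Finset V} {c : ℝ} (hclam : c ≤ lam)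
    (hF : ∀ x : V → ℝ, (∀ j ∉ F, x j = 0) → x ⬝ᵥ G.adjMatrix ℝ *ᵥ x ≤ c * (x ⬝ᵥ x))
    (hcpos : 0 ≤ lam + c) (x : V → ℝ) :
    0 ≤ x ⬝ᵥ restrictMatrix F (lazyMatrix G lam) *ᵥ x ∧
      x ⬝ᵥ restrictMatrix F (lazyMatrix G lam) *ᵥ x ≤ (lam + c) * (x ⬝ᵥ x) := by
  rw [dotProduct_restrictMatrix, lazyMatrix_form]
  set y : V → ℝ := fun i => if i ∈ F then x i else 0 with hy
  have hsupp : ∀ j ∉ F, y j = 0 := fun j hj => by simp [hy, hj]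
  have h1 := hF y hsupp
  have h2 := hF |y| fun j hj => by simp [hsupp j hj]
  rw [dotProduct_abs_self] at h2
  have h3 := neg_le_of_abs_le ((adjMatrix_form_abs G y).trans h2)
  have h4 : y ⬝ᵥ y ≤ x ⬝ᵥ x := by
    refine Finset.sum_le_sum fun i _ => ?_
    by_cases hi : i ∈ F
    · simp [hy, hi]
    · simp [hy, hi, mul_self_nonneg]
  have h5 : 0 ≤ y ⬝ᵥ y := Finset.sum_nonneg fun i _ => mul_self_nonneg _
  constructor
  · nlinarith
  · nlinarith

omit [Fintype V] in
/-- A closed walk as a sequence indexed by `ℕ`, constant after its last step. -/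
theorem exists_nat_steps {p : ℕ} {w : Fin (p + 1) → V}
    (hw : closedWeight (lazyMatrix G lam) w ≠ 0) :
    ∃ g : ℕ → V, (∀ t : Fin (p + 1), g t = w t) ∧
      ∀ t < p, G.edist (g t) (g (t + 1)) ≤ 1 := by
  refine ⟨fun t => w ⟨min t p, by omega⟩, fun t => ?_, fun t ht => ?_⟩
  · exact congrArg w (Fin.ext (min_eq_left (Nat.le_of_lt_succ t.2)))
  · have h := edist_le_one_of_lazyMatrix_ne_zero
      (step_ne_zero_of_closedWeight_ne_zero hw ⟨t, ht⟩)
    convert h using 3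
    · simp; omega
    · simp; omega

omit [Fintype V] in
theorem edist_le_of_closedWeight_ne_zero {p : ℕ} {w : Fin (p + 1) → V}
    (hw : closedWeight (lazyMatrix G lam) w ≠ 0) (s t : Fin (p + 1)) :
    G.edist (w s) (w t) ≤ p := by
  obtain ⟨g, hg, hstep⟩ := exists_nat_steps hw
  wlog hst : s ≤ t generalizing s t
  · rw [SimpleGraph.edist_comm]
    exact this t s (le_of_not_ge hst)
  have hst' : (s : ℕ) ≤ t := hst
  have h := G.edist_le_of_steps hstep s (t - s) (by omega)
  rw [Nat.add_sub_cancel' hst', hg, hg] at h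
  refine h.trans ?_
  have : (t : ℕ) - s ≤ p := by omega
  exact_mod_cast this

/-- The closed walks through a given vertex `i` have total weight at most `(2 * lam) ^ p`: all of
them lie in a ball around `i`, and deleting `i` from that ball moves the trace by one eigenvalue. -/
theorem sum_closedWeight_through_le (hlam : 0 ≤ lam) {p : ℕ} (hp : p ≠ 0) (i : V)
    (ha : ∀ x : V → ℝ, (∀ j ∉ G.ballFinset p i, x j = 0) →
      x ⬝ᵥ G.adjMatrix ℝ *ᵥ x ≤ lam * (x ⬝ᵥ x)) :
    (∑ w : Fin (p + 1) → V, if ∃ t, w t = i then closedWeight (lazyMatrix G lam) w else 0) ≤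
      (2 * lam) ^ p := by
  set M := lazyMatrix G lam with hM
  set B := G.ballFinset p i with hB
  have hb := lazyMatrix_restrict_bounds le_rfl ha (by linarith : 0 ≤ lam + lam)
  have hb' := lazyMatrix_restrict_bounds (F := B.erase i) le_rfl
    (fun x hx => ha x fun j hj => hx j fun h => hj (Finset.mem_of_mem_erase h))
    (by linarith : 0 ≤ lam + lam)
  have hH := isHermitian_lazyMatrix G lam
  have h1 := (isHermitian_restrictMatrix B hH).trace_pow_le_trace_pow_add
    (isHermitian_restrictMatrix (B.erase i) hH) i
    (fun x hx => by
      rw [dotProduct_restrictMatrix, dotProduct_restrictMatrix]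
      have : (fun j => if j ∈ B.erase i then x j else 0) = fun j => if j ∈ B then x j else 0 := by
        funext j
        by_cases hj : j = i
        · subst hj; simp [hx]
        · simp [hj]
      rw [this])
    (lam + lam) (fun x => (hb x).1) (fun x => (hb' x).1) (fun x => (hb x).2) p
  rw [trace_restrictMatrix_pow _ _ hp, trace_restrictMatrix_pow _ _ hp] at h1
  rw [two_mul]
  refine le_trans ?_ (sub_le_iff_le_add'.2 h1)
  rw [← Finset.sum_sub_distrib]
  refine Finset.sum_le_sum fun w _ => ?_
  by_cases hw : closedWeight M w = 0
  · rw [← hM, hw]; simp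
  · by_cases hi : ∃ t, w t = i
    · have h2 : ∀ t, w t ∈ B := by
        obtain ⟨s, rfl⟩ := hi
        exact fun t => SimpleGraph.mem_ballFinset.2 (edist_le_of_closedWeight_ne_zero hw s t)
      have h3 : ¬ ∀ t, w t ∈ B.erase i := by
        obtain ⟨s, hs⟩ := hi
        exact fun h => by simpa [hs] using h s
      rw [if_pos hi, if_pos h2, if_neg h3, sub_zero]
    · have h3 : (∀ t, w t ∈ B.erase i) ↔ ∀ t, w t ∈ B :=
        forall_congr' fun t => by
          rw [Finset.mem_erase]
          exact and_iff_right fun h => hi ⟨t, h⟩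
      rw [if_neg hi, if_congr h3 rfl rfl, sub_self]

/-- A closed lazy walk on at most `h` vertices stays in the ball of radius `h` around its start. -/
theorem image_subset_ballFinset {p : ℕ} {w : Fin (p + 1) → V}
    (hw : closedWeight (lazyMatrix G lam) w ≠ 0) {h : ℕ}
    (hh : (Finset.univ.image w).card ≤ h) (t : Fin (p + 1)) :
    w t ∈ G.ballFinset h (w 0) := by
  obtain ⟨g, hg, hstep⟩ := exists_nat_steps hw
  have h1 := G.edist_le_card_image hstep p le_rfl t (by omega)
  have h2 : (Finset.range (p + 1)).image g ⊆ Finset.univ.image w := by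
    intro v hv
    obtain ⟨s, hs, rfl⟩ := Finset.mem_image.1 hv
    exact Finset.mem_image.2
      ⟨⟨s, Finset.mem_range.1 hs⟩, Finset.mem_univ _, (hg ⟨s, Finset.mem_range.1 hs⟩).symm⟩
  rw [SimpleGraph.mem_ballFinset, ← hg t, show w 0 = g 0 from (hg 0).symm]
  refine h1.trans ?_
  have := (Finset.card_le_card h2).trans hh
  exact_mod_cast this

omit [Fintype V] in
theorem exists_fin_image_eq {S : Finset V} (hS : S.Nonempty) {h : ℕ} (hc : S.card ≤ h) :
    ∃ f : Fin h → V, Finset.univ.image f = S := by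
  have : Nonempty S := hS.to_subtype
  obtain ⟨e⟩ : Nonempty (S ↪ Fin h) :=
    Function.Embedding.nonempty_of_card_le (by simpa using hc)
  refine ⟨fun i => (Function.invFun e i : S), ?_⟩
  ext v
  simp only [Finset.mem_image, Finset.mem_univ, true_and]
  constructor
  · rintro ⟨i, rfl⟩
    exact Subtype.property _
  · intro hv
    exact ⟨e ⟨v, hv⟩, by rw [Function.leftInverse_invFun e.injective]⟩

/-- Closed walks visiting at most `h` vertices have small total weight if all sets of at most `h`
vertices have spectral radius at most `lam - ε`. There are few sets of vertices that such a walk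
can visit, since it stays within distance `h` of its start. -/
theorem sum_closedWeight_small_le {D : ℕ} (hD : ∀ v, G.degree v ≤ D) (hlam : 0 ≤ lam) {ε : ℝ}
    (hε : 0 ≤ ε) (hε' : ε ≤ 2 * lam) {h p : ℕ} (hp : p ≠ 0)
    (hb : ∀ F : Finset V, F.card ≤ h → ∀ x : V → ℝ, (∀ j ∉ F, x j = 0) →
      x ⬝ᵥ G.adjMatrix ℝ *ᵥ x ≤ (lam - ε) * (x ⬝ᵥ x)) :
    (∑ w : Fin (p + 1) → V, if (Finset.univ.image w).card ≤ h then
      closedWeight (lazyMatrix G lam) w else 0) ≤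
      Fintype.card V * (D + 1) ^ (h * h) * h * (2 * lam - ε) ^ p := by
  set M := lazyMatrix G lam with hM
  have hnn : ∀ w : Fin (p + 1) → V, 0 ≤ closedWeight M w :=
    fun w => closedWeight_nonneg (lazyMatrix_nonneg hlam) w
  have hF : ∀ f : Fin h → V, (restrictMatrix (Finset.univ.image f) M ^ p).trace ≤
      h * (2 * lam - ε) ^ p := by
    intro f
    have hcard : (Finset.univ.image f).card ≤ h := by
      simpa using Finset.card_image_le (s := Finset.univ) (f := f)
    have h1 := lazyMatrix_restrict_bounds (lam := lam) (c := lam - ε) (by linarith) (hb _ hcard)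
      (by linarith)
    have h2 := (isHermitian_restrictMatrix (Finset.univ.image f)
      (isHermitian_lazyMatrix G lam)).trace_pow_le_card_mul (Finset.univ.image f)
      (fun i hi j => by simp only [restrictMatrix, Matrix.of_apply, hi, false_and, if_false])
      (fun x => (h1 x).1) (fun x => (h1 x).2) hp
    rw [show lam + (lam - ε) = 2 * lam - ε by ring] at h2
    refine h2.trans ?_
    have h3 : (0 : ℝ) ≤ (2 * lam - ε) ^ p := pow_nonneg (by linarith) p
    exact mul_le_mul_of_nonneg_right (by exact_mod_cast hcard) h3
  calc _ ≤ ∑ w : Fin (p + 1) → V, ∑ j : V, ∑ f ∈ Fintype.piFinset fun _ : Fin h =>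
          G.ballFinset h j, if ∀ t, w t ∈ Finset.univ.image f then closedWeight M w else 0 := by
        refine Finset.sum_le_sum fun w _ => ?_
        have hnn' : ∀ f : Fin h → V,
            0 ≤ if ∀ t, w t ∈ Finset.univ.image f then closedWeight M w else 0 := fun f => by
          split_ifs
          · exact hnn w
          · exact le_rfl
        split_ifs with hw
        swap
        · exact Finset.sum_nonneg fun j _ => Finset.sum_nonneg fun f _ => hnn' f
        by_cases hw0 : closedWeight M w = 0
        · rw [hw0]
          exact Finset.sum_nonneg fun j _ => Finset.sum_nonneg fun f _ => by simp
        obtain ⟨f, hf⟩ := exists_fin_image_eq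
          (⟨w 0, Finset.mem_image_of_mem w (Finset.mem_univ 0)⟩ : (Finset.univ.image w).Nonempty) hw
        have hfmem : f ∈ Fintype.piFinset fun _ : Fin h => G.ballFinset h (w 0) := by
          rw [Fintype.mem_piFinset]
          intro a
          have : f a ∈ Finset.univ.image w := hf ▸ Finset.mem_image_of_mem f (Finset.mem_univ a)
          obtain ⟨t, -, ht⟩ := Finset.mem_image.1 this
          rw [← ht]
          exact image_subset_ballFinset hw0 hw t
        calc closedWeight M w
            = if ∀ t, w t ∈ Finset.univ.image f then closedWeight M w else 0 := by
              rw [if_pos]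
              exact fun t => hf ▸ Finset.mem_image_of_mem w (Finset.mem_univ t)
          _ ≤ _ := Finset.single_le_sum (f := fun f : Fin h → V =>
              if ∀ t, w t ∈ Finset.univ.image f then closedWeight M w else 0)
              (fun f _ => hnn' f) hfmem
          _ ≤ _ := Finset.single_le_sum (f := fun j : V => ∑ f ∈ Fintype.piFinset fun _ : Fin h =>
              G.ballFinset h j, if ∀ t, w t ∈ Finset.univ.image f then closedWeight M w else 0)
              (fun j _ => Finset.sum_nonneg fun f _ => hnn' f) (Finset.mem_univ (w 0))
    _ = ∑ j : V, ∑ f ∈ Fintype.piFinset fun _ : Fin h => G.ballFinset h j,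
          (restrictMatrix (Finset.univ.image f) M ^ p).trace := by
        rw [Finset.sum_comm]
        refine Finset.sum_congr rfl fun j _ => ?_
        rw [Finset.sum_comm]
        exact Finset.sum_congr rfl fun f _ => (trace_restrictMatrix_pow _ M hp).symm
    _ ≤ ∑ j : V, ∑ f ∈ Fintype.piFinset fun _ : Fin h => G.ballFinset h j,
          h * (2 * lam - ε) ^ p :=
        Finset.sum_le_sum fun j _ => Finset.sum_le_sum fun f _ => hF f
    _ ≤ ∑ j : V, (D + 1 : ℝ) ^ (h * h) * (h * (2 * lam - ε) ^ p) := by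
        refine Finset.sum_le_sum fun j _ => ?_
        rw [Finset.sum_const, nsmul_eq_mul]
        have h3 : (0 : ℝ) ≤ (2 * lam - ε) ^ p := pow_nonneg (by linarith) p
        refine mul_le_mul_of_nonneg_right ?_ (by positivity)
        have h4 : (Fintype.piFinset fun _ : Fin h => G.ballFinset h j).card ≤
            (D + 1) ^ (h * h) := by
          rw [Fintype.card_piFinset, Finset.prod_const, Finset.card_univ, Fintype.card_fin, pow_mul]
          exact Nat.pow_le_pow_left (G.card_ballFinset_le hD h j) h
        exact_mod_cast h4
    _ = _ := by
        rw [Finset.sum_const, Finset.card_univ, nsmul_eq_mul]; ring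

/-- **Multiplicity bound.** Suppose that the form of the adjacency matrix is at most `lam` on
balls of radius `p` and at most `lam - ε` on sets of at most `h` vertices. Weight the closed lazy
walks of length `p` by the number of vertices they visit: up to the few walks that visit at most
`h` vertices this gains a factor `h + 1` over the trace, while each vertex is visited with total
weight at most `(2 * lam) ^ p`. -/
theorem finrank_eigenspace_le {D : ℕ} (hD : ∀ v, G.degree v ≤ D) (hlam : 0 ≤ lam) {ε : ℝ}
    (hε : 0 ≤ ε) (hε' : ε ≤ 2 * lam) {h p : ℕ} (hp : p ≠ 0) (hpe : Even p)
    (ha : ∀ i, ∀ x : V → ℝ, (∀ j ∉ G.ballFinset p i, x j = 0) →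
      x ⬝ᵥ G.adjMatrix ℝ *ᵥ x ≤ lam * (x ⬝ᵥ x))
    (hb : ∀ F : Finset V, F.card ≤ h → ∀ x : V → ℝ, (∀ j ∉ F, x j = 0) →
      x ⬝ᵥ G.adjMatrix ℝ *ᵥ x ≤ (lam - ε) * (x ⬝ᵥ x))
    (Y : Submodule ℝ (EuclideanSpace ℝ V))
    (hY : ∀ x ∈ Y, G.adjMatrix ℝ *ᵥ x.ofLp = lam • x.ofLp) :
    (h + 1) * (finrank ℝ Y * (2 * lam) ^ p) ≤ Fintype.card V * (2 * lam) ^ p +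
      (h + 1) * (Fintype.card V * (D + 1) ^ (h * h) * h * (2 * lam - ε) ^ p) := by
  set M := lazyMatrix G lam with hM
  have hnn : ∀ w : Fin (p + 1) → V, 0 ≤ closedWeight M w :=
    fun w => closedWeight_nonneg (lazyMatrix_nonneg hlam) w
  have h1 := (isHermitian_lazyMatrix G lam).finrank_mul_pow_le_trace_pow
    (by linarith : 0 ≤ 2 * lam) Y
    (fun x hx => by
      rw [lazyMatrix_form, hY x hx, dotProduct_smul, smul_eq_mul]
      exact le_of_eq (by ring)) hpe
  rw [trace_pow_eq_sum_closedWeight] at h1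
  have h2 := sum_closedWeight_small_le hD hlam hε hε' hp hb
  have h3 : ∑ i : V, ∑ w : Fin (p + 1) → V, (if ∃ t, w t = i then closedWeight M w else 0) ≤
      ∑ i : V, (2 * lam) ^ p :=
    Finset.sum_le_sum fun i _ => sum_closedWeight_through_le hlam hp i (ha i)
  rw [Finset.sum_const, Finset.card_univ, nsmul_eq_mul, Finset.sum_comm] at h3
  have h4 : ∀ w : Fin (p + 1) → V,
      (h + 1) * closedWeight M w ≤ ∑ i : V, (if ∃ t, w t = i then closedWeight M w else 0) +
        (h + 1) * (if (Finset.univ.image w).card ≤ h then closedWeight M w else 0) := by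
    intro w
    have h5 : ∑ i : V, (if ∃ t, w t = i then closedWeight M w else 0) =
        (Finset.univ.image w).card * closedWeight M w := by
      rw [← Finset.sum_filter, Finset.sum_const, nsmul_eq_mul]
      congr 3
      ext i
      simp
    rw [h5]
    split_ifs with hc
    · have := mul_nonneg (Nat.cast_nonneg (α := ℝ) (Finset.univ.image w).card) (hnn w)
      linarith
    · have h6 : ((h + 1 : ℕ) : ℝ) ≤ (Finset.univ.image w).card := by
        exact_mod_cast not_le.1 hc
      push_cast at h6
      have := mul_le_mul_of_nonneg_right h6 (hnn w)
      linarith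
  have h7 := Finset.sum_le_sum fun w (_ : w ∈ Finset.univ) => h4 w
  rw [← Finset.mul_sum, Finset.sum_add_distrib, ← Finset.mul_sum] at h7
  have h8 : (0 : ℝ) ≤ h + 1 := by positivity
  have h9 := mul_le_mul_of_nonneg_left h1 h8
  have h10 := mul_le_mul_of_nonneg_left h2 h8
  linarith

end

end Multiplicity

/-! ### Switching to a graph of bounded degree -/

section Ramsey

/-- Ramsey's theorem, with the bound `2 ^ (a + b)`. -/
theorem exists_clique_or_indep {V : Type*} [DecidableEq V] (G : SimpleGraph V) (a b : ℕ)
    (X : Finset V) (hX : 2 ^ (a + b) ≤ X.card) :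
    (∃ S ⊆ X, S.card = a ∧ (S : Set V).Pairwise G.Adj) ∨
      (∃ S ⊆ X, S.card = b ∧ (S : Set V).Pairwise fun i j => ¬ G.Adj i j) := by
  classical
  induction hn : a + b generalizing a b X with
  | zero =>
    left
    exact ⟨∅, by simp, by simp; omega, by simp⟩
  | succ n ih =>
    rcases Nat.eq_zero_or_pos a with rfl | ha
    · left; exact ⟨∅, by simp, by simp, by simp⟩
    rcases Nat.eq_zero_or_pos b with rfl | hb
    · right; exact ⟨∅, by simp, by simp, by simp⟩
    rw [hn, pow_succ] at hX
    have hpos : 0 < 2 ^ n := by positivity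
    obtain ⟨x, hx⟩ : X.Nonempty := Finset.card_pos.1 (by omega)
    have hsplit := Finset.card_filter_add_card_filter_not (s := X.erase x) (fun y => G.Adj x y)
    rw [Finset.card_erase_of_mem hx] at hsplit
    have hsub : ∀ q : V → Prop, [DecidablePred q] → (X.erase x).filter q ⊆ X := fun q _ =>
      (Finset.filter_subset _ _).trans (Finset.erase_subset _ _)
    have key : ∀ (r : V → V → Prop), (∀ i j, r i j → r j i) → ∀ T, T ⊆ X.erase x →
        (∀ y ∈ T, r x y) → ∀ S ⊆ T, (S : Set V).Pairwise r →
        insert x S ⊆ X ∧ (insert x S).card = S.card + 1 ∧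
          ((insert x S : Finset V) : Set V).Pairwise r := by
      intro r hr T hT hTr S hS hSr
      have hxS : x ∉ S := fun h => Finset.notMem_erase x X (hT (hS h))
      refine ⟨?_, Finset.card_insert_of_notMem hxS, ?_⟩
      · exact Finset.insert_subset hx ((hS.trans hT).trans (Finset.erase_subset _ _))
      · rw [Finset.coe_insert]
        exact hSr.insert fun y hy _ => ⟨hTr y (hS hy), hr _ _ (hTr y (hS hy))⟩
    rcases Nat.lt_or_ge ((X.erase x).filter fun y => G.Adj x y).card (2 ^ n) with h | h
    · have h2 : 2 ^ (a + (b - 1)) ≤ ((X.erase x).filter fun y => ¬ G.Adj x y).card := by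
        rw [show a + (b - 1) = n by omega]; omega
      rcases ih a (b - 1) _ h2 (by omega) with ⟨S, hS, hc, hp⟩ | ⟨S, hS, hc, hp⟩
      · exact Or.inl ⟨S, hS.trans (hsub _), hc, hp⟩
      · obtain ⟨k1, k2, k3⟩ := key (fun i j => ¬ G.Adj i j) (fun i j h h' => h h'.symm) _
          (Finset.filter_subset _ _) (fun y hy => (Finset.mem_filter.1 hy).2) S hS hp
        exact Or.inr ⟨_, k1, by omega, k3⟩
    · have h2 : 2 ^ (a - 1 + b) ≤ ((X.erase x).filter fun y => G.Adj x y).card := by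
        rw [show a - 1 + b = n by omega]; exact h
      rcases ih (a - 1) b _ h2 (by omega) with ⟨S, hS, hc, hp⟩ | ⟨S, hS, hc, hp⟩
      · obtain ⟨k1, k2, k3⟩ := key G.Adj (fun i j h => h.symm) _
          (Finset.filter_subset _ _) (fun y hy => (Finset.mem_filter.1 hy).2) S hS hp
        exact Or.inl ⟨_, k1, by omega, k3⟩
      · exact Or.inr ⟨S, hS.trans (hsub _), hc, hp⟩

end Ramsey

section Switching

variable {ι E : Type*} [NormedAddCommGroup E] [InnerProductSpace ℝ E]

open scoped InnerProductSpace

/-- Direction vectors of equiangular lines, scaled so that the inner products are `1 / 2` and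
`-1 / 2`. The common angle is then `arccos (1 / (2 * lam + 1))`. -/
structure IsEquiangularFamily (lam : ℝ) (v : ι → E) : Prop where
  inner_self : ∀ i, ⟪v i, v i⟫_ℝ = lam + 1 / 2
  inner_of_ne : ∀ i j, i ≠ j → ⟪v i, v j⟫_ℝ = 1 / 2 ∨ ⟪v i, v j⟫_ℝ = -(1 / 2)

/-- The graph of the pairs of vectors with negative inner product. -/
def negGraph (v : ι → E) : SimpleGraph ι where
  Adj i j := i ≠ j ∧ ⟪v i, v j⟫_ℝ < 0
  symm := ⟨fun i j h => ⟨h.1.symm, by rw [real_inner_comm]; exact h.2⟩⟩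
  loopless := ⟨fun i h => h.1 rfl⟩

variable {lam : ℝ} {v : ι → E}

namespace IsEquiangularFamily

theorem inner_of_adj (hv : IsEquiangularFamily lam v) {i j : ι} (h : (negGraph v).Adj i j) :
    ⟪v i, v j⟫_ℝ = -(1 / 2) := by
  rcases hv.inner_of_ne i j h.1 with h1 | h1
  · have := h.2; rw [h1] at this; norm_num at this
  · exact h1

theorem inner_of_not_adj (hv : IsEquiangularFamily lam v) {i j : ι} (hij : i ≠ j)
    (h : ¬ (negGraph v).Adj i j) : ⟪v i, v j⟫_ℝ = 1 / 2 := by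
  rcases hv.inner_of_ne i j hij with h1 | h1
  · exact h1
  · exact absurd ⟨hij, by rw [h1]; norm_num⟩ h

theorem smul_sign (hv : IsEquiangularFamily lam v) {ε : ι → ℝ} (hε : ∀ i, ε i = 1 ∨ ε i = -1) :
    IsEquiangularFamily lam fun i => ε i • v i := by
  refine ⟨fun i => ?_, fun i j hij => ?_⟩
  · have h1 := hv.inner_self i
    rcases hε i with h | h <;> simpa [h] using h1
  · rcases hε i with h | h <;> rcases hε j with h' | h' <;>
      rcases hv.inner_of_ne i j hij with h1 | h1 <;>
      simp [h, h', h1, inner_neg_left, inner_neg_right]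

theorem inner_sum_sum_self (hv : IsEquiangularFamily lam v) [DecidableEq ι] (S : Finset ι) (c : ℝ)
    (hS : (S : Set ι).Pairwise fun i j => ⟪v i, v j⟫_ℝ = c) :
    ⟪∑ i ∈ S, v i, ∑ i ∈ S, v i⟫_ℝ = S.card * (lam + 1 / 2) + c * (S.card * (S.card - 1)) := by
  rw [sum_inner]
  have h : ∀ i ∈ S, ⟪v i, ∑ j ∈ S, v j⟫_ℝ = (lam + 1 / 2) + c * (S.card - 1) := by
    intro i hi
    rw [inner_sum, ← Finset.add_sum_erase _ _ hi, hv.inner_self]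
    rw [Finset.sum_congr rfl fun j hj => hS hi (Finset.mem_of_mem_erase hj)
      (Finset.ne_of_mem_erase hj).symm]
    rw [Finset.sum_const, Finset.card_erase_of_mem hi, nsmul_eq_mul,
      Nat.cast_sub (Finset.card_pos.2 ⟨i, hi⟩)]
    push_cast; ring
  rw [Finset.sum_congr rfl h, Finset.sum_const, nsmul_eq_mul]
  ring

/-- Mutually negative vectors: their sum has nonnegative squared length. -/
theorem card_le_of_clique (hv : IsEquiangularFamily lam v) (hlam : 0 ≤ lam) {S : Finset ι}
    (hS : (S : Set ι).Pairwise (negGraph v).Adj) : (S.card : ℝ) ≤ 2 * lam + 2 := by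
  classical
  have h := hv.inner_sum_sum_self S (-(1 / 2)) fun i hi j hj hij => hv.inner_of_adj (hS hi hj hij)
  have h0 : 0 ≤ ⟪∑ i ∈ S, v i, ∑ i ∈ S, v i⟫_ℝ := real_inner_self_nonneg
  by_contra hlt
  push Not at hlt
  have hpos : (0 : ℝ) < S.card := by linarith
  nlinarith

theorem inner_sum_indep (hv : IsEquiangularFamily lam v) {S : Finset ι}
    (hS : (S : Set ι).Pairwise fun i j => ¬ (negGraph v).Adj i j) :
    ⟪∑ i ∈ S, v i, ∑ i ∈ S, v i⟫_ℝ = S.card * lam + (S.card : ℝ) ^ 2 / 2 := by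
  classical
  rw [hv.inner_sum_sum_self S (1 / 2) fun i hi j hj hij => hv.inner_of_not_adj hij (hS hi hj hij)]
  ring

/-- A vector that is negative to at most half of a large mutually positive set `S` is negative to
only `5 * lam ^ 2` of its members. -/
theorem card_neg_le (hv : IsEquiangularFamily lam v) (hlam : 1 ≤ lam) {S : Finset ι}
    (hS : (S : Set ι).Pairwise fun i j => ¬ (negGraph v).Adj i j)
    (ht : 16 * lam ^ 2 ≤ S.card) {i : ι} (hi : i ∉ S) {N P : Finset ι} (hN : N ⊆ S) (hP : P ⊆ S)
    (hNi : ∀ j ∈ N, (negGraph v).Adj i j) (hPi : ∀ j ∈ P, ¬ (negGraph v).Adj i j)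
    (hNP : N.card + P.card = S.card) (hle : N.card ≤ P.card) :
    (N.card : ℝ) ≤ 5 * lam ^ 2 := by
  set a : ℝ := (N.card : ℝ) with ha
  set b : ℝ := (P.card : ℝ) with hb
  have hab : a ≤ b := by rw [ha, hb]; exact_mod_cast hle
  have habt : a + b = S.card := by rw [ha, hb]; exact_mod_cast hNP
  have ha0 : 0 ≤ a := Nat.cast_nonneg _
  have hb8 : 8 * lam ^ 2 ≤ b := by linarith
  have hb0 : 0 < b := by nlinarith
  have h1 := hv.inner_sum_indep (hS.mono (Finset.coe_subset.2 hN))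
  have h2 := hv.inner_sum_indep (hS.mono (Finset.coe_subset.2 hP))
  have h3 : ⟪v i, ∑ j ∈ N, v j⟫_ℝ = -(a / 2) := by
    rw [inner_sum, Finset.sum_congr rfl fun j hj => hv.inner_of_adj (hNi j hj)]
    simp [ha]; ring
  have h4 : ⟪v i, ∑ j ∈ P, v j⟫_ℝ = b / 2 := by
    rw [inner_sum, Finset.sum_congr rfl fun j hj => hv.inner_of_not_adj (i := i) (j := j)
      (fun h => hi (h ▸ hP hj)) (hPi j hj)]
    simp [hb]; ring
  have h5 : ⟪∑ j ∈ N, v j, ∑ j ∈ P, v j⟫_ℝ = a * b / 2 := by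
    rw [sum_inner]
    have : ∀ j ∈ N, ⟪v j, ∑ l ∈ P, v l⟫_ℝ = b / 2 := by
      intro j hj
      rw [inner_sum, Finset.sum_congr rfl fun l hl => hv.inner_of_not_adj (i := j) (j := l)
        (fun h => hPi l hl (h ▸ hNi j hj))
        (hS (hN hj) (hP hl) (fun h => hPi l hl (h ▸ hNi j hj)))]
      simp [hb]; ring
    rw [Finset.sum_congr rfl this]
    simp [ha]; ring
  have h6 := hv.inner_self i
  -- The coefficient of `P` gives the test vector coordinate sum zero.
  have h7 : 0 ≤ ⟪(2 * lam) • v i + ∑ j ∈ N, v j - ((2 * lam + a) / b) • ∑ j ∈ P, v j,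
      (2 * lam) • v i + ∑ j ∈ N, v j - ((2 * lam + a) / b) • ∑ j ∈ P, v j⟫_ℝ :=
    real_inner_self_nonneg
  simp only [inner_sub_left, inner_sub_right, inner_add_left, inner_add_right, inner_smul_left,
    inner_smul_right, conj_trivial] at h7
  rw [real_inner_comm (v i) (∑ j ∈ N, v j), real_inner_comm (v i) (∑ j ∈ P, v j),
    real_inner_comm (∑ j ∈ N, v j) (∑ j ∈ P, v j), h1, h2, h3, h4, h5, h6] at h7
  have h8 : 0 ≤ lam * (4 * lam ^ 2 + a + (2 * lam + a) ^ 2 / b) - 4 * lam * a := by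
    refine h7.trans (le_of_eq ?_)
    field_simp
    ring
  have h9 : (2 * lam + a) ^ 2 / b ≤ 1 + 2 * a := by
    rw [div_le_iff₀ hb0]
    nlinarith [sq_nonneg (2 * lam - a), mul_le_mul_of_nonneg_left hab ha0]
  have h10 : 0 ≤ 4 * lam ^ 2 + a + (1 + 2 * a) - 4 * a := by
    by_contra hneg
    push Not at hneg
    nlinarith
  nlinarith

/-- A mutually positive set `S` that is negative to no vector too often excludes the star with
`3 * lam ^ 2` mutually positive leaves. -/
theorem false_of_star (hv : IsEquiangularFamily lam v) (hlam : 1 ≤ lam) {S : Finset ι}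
    (hS : (S : Set ι).Pairwise fun i j => ¬ (negGraph v).Adj i j)
    (ht : 176 * lam ^ 3 ≤ S.card)
    (hS' : ∀ i, (S.card : ℝ) / 2 - 5 * lam ^ 2 ≤ ⟪v i, ∑ j ∈ S, v j⟫_ℝ) (i : ι) {T : Finset ι}
    (hT : (T : Set ι).Pairwise fun i j => ¬ (negGraph v).Adj i j)
    (hTi : ∀ j ∈ T, (negGraph v).Adj i j) (hTc : (T.card : ℝ) = 3 * lam ^ 2) : False := by
  set t : ℝ := (S.card : ℝ) with htdef
  have ht0 : 0 < t := by
    have : 0 < lam ^ 3 := by positivity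
    linarith
  have h1 := hv.inner_sum_indep hT
  have h2 := hv.inner_sum_indep hS
  rw [hTc] at h1
  rw [← htdef] at h2
  have h3 : ⟪v i, ∑ j ∈ T, v j⟫_ℝ = -(3 * lam ^ 2 / 2) := by
    rw [inner_sum, Finset.sum_congr rfl fun j hj => hv.inner_of_adj (hTi j hj)]
    rw [Finset.sum_const, nsmul_eq_mul, hTc]; ring
  have h4 := hS' i
  have h5 : 3 * lam ^ 2 * (t / 2 - 5 * lam ^ 2) ≤ ⟪∑ j ∈ T, v j, ∑ j ∈ S, v j⟫_ℝ := by
    rw [sum_inner, ← hTc, ← nsmul_eq_mul, ← Finset.sum_const]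
    exact Finset.sum_le_sum fun j _ => hS' j
  have h6 := hv.inner_self i
  set c : ℝ := lam + 3 * lam ^ 2 with hc
  have hc0 : 0 < c := by positivity
  -- The coefficient of `S` gives the test vector coordinate sum zero.
  have h7 : 0 ≤ ⟪lam • v i + ∑ j ∈ T, v j - (c / t) • ∑ j ∈ S, v j,
      lam • v i + ∑ j ∈ T, v j - (c / t) • ∑ j ∈ S, v j⟫_ℝ := real_inner_self_nonneg
  simp only [inner_sub_left, inner_sub_right, inner_add_left, inner_add_right, inner_smul_left,
    inner_smul_right, conj_trivial] at h7
  rw [real_inner_comm (v i) (∑ j ∈ T, v j), real_inner_comm (v i) (∑ j ∈ S, v j),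
    real_inner_comm (∑ j ∈ T, v j) (∑ j ∈ S, v j), h1, h2, h3, h6] at h7
  set p := ⟪v i, ∑ j ∈ S, v j⟫_ℝ
  set q := ⟪∑ j ∈ T, v j, ∑ j ∈ S, v j⟫_ℝ
  have h8 : c * (t / 2 - 5 * lam ^ 2) ≤ lam * p + q := by
    have := mul_le_mul_of_nonneg_left h4 (by linarith : 0 ≤ lam)
    rw [hc, add_mul]
    linarith
  have h9 : 2 * (c / t) * (c * (t / 2 - 5 * lam ^ 2)) ≤ 2 * (c / t) * (lam * p + q) :=
    mul_le_mul_of_nonneg_left h8 (by positivity)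
  have h10 : 0 ≤ -2 * lam ^ 3 + c ^ 2 * (10 * lam ^ 2 + lam) / t := by
    have e1 : 2 * (c / t) * (c * (t / 2 - 5 * lam ^ 2)) = c ^ 2 - c ^ 2 * (10 * lam ^ 2) / t := by
      field_simp
      ring
    have e2 : (c / t) * ((c / t) * (t * lam + t ^ 2 / 2)) = c ^ 2 * lam / t + c ^ 2 / 2 := by
      field_simp
    have e3 : c ^ 2 * (10 * lam ^ 2 + lam) / t = c ^ 2 * (10 * lam ^ 2) / t + c ^ 2 * lam / t := by
      ring
    rw [e1] at h9
    rw [e3]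
    have e4 : c ^ 2 / 2 = lam ^ 2 / 2 + 3 * lam ^ 3 + 9 * lam ^ 4 / 2 := by rw [hc]; ring
    nlinarith
  have h11 : c ^ 2 * (10 * lam ^ 2 + lam) / t ≤ lam ^ 3 := by
    rw [div_le_iff₀ ht0]
    have e1 : c ≤ 4 * lam ^ 2 := by nlinarith
    have e2 : 10 * lam ^ 2 + lam ≤ 11 * lam ^ 2 := by nlinarith
    calc c ^ 2 * (10 * lam ^ 2 + lam) ≤ (4 * lam ^ 2) ^ 2 * (11 * lam ^ 2) := by gcongr
      _ = lam ^ 3 * (176 * lam ^ 3) := by ring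
      _ ≤ lam ^ 3 * t := by gcongr
  have : 0 < lam ^ 3 := by positivity
  linarith

/-- A large equiangular family can be switched so that every vector is negative to boundedly many
others. -/
theorem exists_switching [Fintype ι] [DecidableEq ι] {l : ℕ} (hl : 1 ≤ l)
    (hv : IsEquiangularFamily (l : ℝ) v)
    (hcard : 2 ^ (2 * l + 3 + 176 * l ^ 3) ≤ Fintype.card ι) :
    ∃ w : ι → E, IsEquiangularFamily (l : ℝ) w ∧
      ∀ i, ∀ X : Finset ι, (∀ j ∈ X, (negGraph w).Adj i j) →
        X.card < 2 ^ (2 * l + 3 + 3 * l ^ 2) := by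
  classical
  have hl' : (1 : ℝ) ≤ l := by exact_mod_cast hl
  have hclique : ∀ w : ι → E, IsEquiangularFamily (l : ℝ) w → ∀ S : Finset ι,
      S.card = 2 * l + 3 → ¬ (S : Set ι).Pairwise (negGraph w).Adj := by
    intro w hw S hS hp
    have := hw.card_le_of_clique (by linarith) hp
    rw [hS] at this
    push_cast at this
    linarith
  rcases exists_clique_or_indep (negGraph v) (2 * l + 3) (176 * l ^ 3) Finset.univ
    (by simpa using hcard) with ⟨S, -, hSc, hS⟩ | ⟨S, -, hSc, hS⟩
  · exact absurd hS (hclique v hv S hSc)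
  have hScR : (S.card : ℝ) = 176 * (l : ℝ) ^ 3 := by rw [hSc]; push_cast; ring
  set ε : ι → ℝ := fun i =>
    if 2 * (S.filter fun j => (negGraph v).Adj i j).card ≤ S.card then 1 else -1 with hε
  have hε1 : ∀ i, ε i = 1 ∨ ε i = -1 := fun i => by
    simp only [hε]; split_ifs <;> simp
  have hεS : ∀ i ∈ S, ε i = 1 := by
    intro i hi
    have : (S.filter fun j => (negGraph v).Adj i j) = ∅ := by
      refine Finset.filter_eq_empty_iff.2 fun j hj h => hS hi hj h.1 h
    simp [hε, this]
  set w : ι → E := fun i => ε i • v i with hw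
  have hwf : IsEquiangularFamily (l : ℝ) w := hv.smul_sign hε1
  have hadj_pos : ∀ i, ε i = 1 → ∀ j ∈ S, ((negGraph w).Adj i j ↔ (negGraph v).Adj i j) := by
    intro i hi j hj
    simp [negGraph, hw, hi, hεS j hj]
  have hadj_neg : ∀ i, ε i = -1 → ∀ j ∈ S, ((negGraph w).Adj i j ↔ ¬ (negGraph v).Adj i j) := by
    intro i hi j hj
    have hij : i ≠ j := by
      rintro rfl
      have := hεS i hj
      rw [hi] at this; norm_num at this
    have : (negGraph w).Adj i j ↔ 0 < ⟪v i, v j⟫_ℝ := by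
      simp [negGraph, hw, hi, hεS j hj, hij, inner_neg_left]
    rw [this]
    constructor
    · exact fun h h' => absurd h'.2 (not_lt.2 h.le)
    · intro h
      rw [hv.inner_of_not_adj hij h]; norm_num
  have hSw : (S : Set ι).Pairwise fun i j => ¬ (negGraph w).Adj i j :=
    fun i hi j hj hij h => hS hi hj hij ((hadj_pos i (hεS i hi) j hj).1 h)
  have hhalf : ∀ i, (S.filter fun j => (negGraph w).Adj i j).card ≤
      (S.filter fun j => ¬ (negGraph w).Adj i j).card := by
    intro i
    have hsum := Finset.card_filter_add_card_filter_not (s := S) (fun j => (negGraph v).Adj i j)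
    by_cases h : 2 * (S.filter fun j => (negGraph v).Adj i j).card ≤ S.card
    · have hi : ε i = 1 := by simp [hε, h]
      have e1 : (S.filter fun j => (negGraph w).Adj i j) =
          S.filter fun j => (negGraph v).Adj i j := Finset.filter_congr (hadj_pos i hi)
      have e2 : (S.filter fun j => ¬ (negGraph w).Adj i j) =
          S.filter fun j => ¬ (negGraph v).Adj i j :=
        Finset.filter_congr fun j hj => by rw [hadj_pos i hi j hj]
      rw [e1, e2]
      omega
    · have hi : ε i = -1 := by simp [hε, h]
      have e1 : (S.filter fun j => (negGraph w).Adj i j) =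
          S.filter fun j => ¬ (negGraph v).Adj i j := Finset.filter_congr (hadj_neg i hi)
      have e2 : (S.filter fun j => ¬ (negGraph w).Adj i j) =
          S.filter fun j => (negGraph v).Adj i j :=
        Finset.filter_congr fun j hj => by rw [hadj_neg i hi j hj, not_not]
      rw [e1, e2]
      omega
  have hpow : (l : ℝ) ^ 2 ≤ (l : ℝ) ^ 3 := pow_le_pow_right₀ hl' (by norm_num)
  have hinner : ∀ i, (S.card : ℝ) / 2 - 5 * (l : ℝ) ^ 2 ≤ ⟪w i, ∑ j ∈ S, w j⟫_ℝ := by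
    intro i
    by_cases hi : i ∈ S
    · rw [inner_sum, ← Finset.add_sum_erase _ _ hi, hwf.inner_self]
      rw [Finset.sum_congr rfl fun j hj => hwf.inner_of_not_adj (Finset.ne_of_mem_erase hj).symm
        (hSw hi (Finset.mem_of_mem_erase hj) (Finset.ne_of_mem_erase hj).symm)]
      rw [Finset.sum_const, Finset.card_erase_of_mem hi, nsmul_eq_mul,
        Nat.cast_sub (Finset.card_pos.2 ⟨i, hi⟩)]
      push_cast
      nlinarith
    · have hsum := Finset.card_filter_add_card_filter_not (s := S) (fun j => (negGraph w).Adj i j)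
      have h1 := hwf.card_neg_le hl' hSw (by rw [hScR]; nlinarith) hi
        (Finset.filter_subset _ _) (Finset.filter_subset _ _)
        (fun j hj => (Finset.mem_filter.1 hj).2) (fun j hj => (Finset.mem_filter.1 hj).2)
        hsum (hhalf i)
      rw [inner_sum, ← Finset.sum_filter_add_sum_filter_not S fun j => (negGraph w).Adj i j]
      rw [Finset.sum_congr rfl fun j hj => hwf.inner_of_adj (Finset.mem_filter.1 hj).2]
      rw [Finset.sum_congr (s₁ := S.filter fun j => ¬ (negGraph w).Adj i j) rfl fun j hj =>
        hwf.inner_of_not_adj (i := i) (j := j)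
          (fun h => hi (h ▸ (Finset.mem_filter.1 hj).1)) (Finset.mem_filter.1 hj).2]
      rw [Finset.sum_const, Finset.sum_const, nsmul_eq_mul, nsmul_eq_mul]
      have hsum' : ((S.filter fun j => (negGraph w).Adj i j).card : ℝ) +
          (S.filter fun j => ¬ (negGraph w).Adj i j).card = S.card := by exact_mod_cast hsum
      linarith
  refine ⟨w, hwf, fun i X hX => ?_⟩
  by_contra hlt
  rcases exists_clique_or_indep (negGraph w) (2 * l + 3) (3 * l ^ 2) X
    (not_lt.1 hlt) with ⟨T, -, hTc, hT⟩ | ⟨T, hTX, hTc, hT⟩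
  · exact hclique w hwf T hTc hT
  · exact hwf.false_of_star hl' hSw hScR.ge hinner i hT (fun j hj => hX j (hTX hj))
      (by rw [hTc]; push_cast; ring)

end IsEquiangularFamily

end Switching

/-! ### Adjacency forms on small sets -/

section Forms

open Matrix

variable {V : Type*} [Fintype V] [DecidableEq V] (G : SimpleGraph V) [DecidableRel G.Adj]

omit [DecidableEq V] in
theorem adjMatrix_form_eq_sum (y : V → ℝ) :
    y ⬝ᵥ G.adjMatrix ℝ *ᵥ y = ∑ i, ∑ j, y i * y j * G.adjMatrix ℝ i j := by
  simp only [dotProduct, mulVec, Finset.mul_sum]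
  exact Finset.sum_congr rfl fun i _ => Finset.sum_congr rfl fun j _ => by ring

theorem adjMatrix_form_le_of_nonneg {y : V → ℝ} (hy : ∀ i, 0 ≤ y i) :
    y ⬝ᵥ G.adjMatrix ℝ *ᵥ y ≤ (∑ i, y i) ^ 2 - y ⬝ᵥ y := by
  have h : (∑ i, y i) ^ 2 - y ⬝ᵥ y = ∑ i, ∑ j, y i * y j * (1 - if i = j then 1 else 0) := by
    simp only [mul_sub, mul_one, Finset.sum_sub_distrib, mul_ite, mul_zero]
    simp [sq, Finset.sum_mul_sum, dotProduct]
  rw [h, adjMatrix_form_eq_sum]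
  refine Finset.sum_le_sum fun i _ => Finset.sum_le_sum fun j _ => ?_
  refine mul_le_mul_of_nonneg_left ?_ (mul_nonneg (hy i) (hy j))
  rw [SimpleGraph.adjMatrix_apply]
  by_cases hij : i = j
  · subst hij; simp
  · simp only [hij, if_false, sub_zero]; split_ifs <;> norm_num

theorem adjMatrix_form_le_of_not_adj {y : V → ℝ} (hy : ∀ i, 0 ≤ y i) {a b : V} (hab : a ≠ b)
    (h : ¬ G.Adj a b) :
    y ⬝ᵥ G.adjMatrix ℝ *ᵥ y ≤ (∑ i, y i) ^ 2 - y ⬝ᵥ y - 2 * (y a * y b) := by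
  have hsq : (∑ i, y i) ^ 2 - y ⬝ᵥ y - 2 * (y a * y b) = ∑ i, ∑ j, y i * y j *
      (1 - (if i = j then 1 else 0) - (if i = a then if j = b then 1 else 0 else 0) -
        (if i = b then if j = a then 1 else 0 else 0)) := by
    have e1 : ∀ i j, y i * y j * (1 - (if i = j then 1 else 0) -
        (if i = a then if j = b then 1 else 0 else 0) -
        (if i = b then if j = a then 1 else 0 else 0)) = y i * y j -
        (if i = j then y i * y j else 0) - (if i = a then if j = b then y i * y j else 0 else 0) -
        (if i = b then if j = a then y i * y j else 0 else 0) := by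
      intro i j; split_ifs <;> ring
    simp only [e1, Finset.sum_sub_distrib]
    have e2 : ∀ c d : V, (∑ i, ∑ j, if i = c then if j = d then y i * y j else 0 else 0) =
        y c * y d := by
      intro c d
      rw [Finset.sum_eq_single c (fun i _ hi => by simp [hi]) (by simp)]
      simp
    rw [e2, e2]
    simp [sq, Finset.sum_mul_sum, dotProduct]
    ring
  rw [hsq, adjMatrix_form_eq_sum]
  refine Finset.sum_le_sum fun i _ => Finset.sum_le_sum fun j _ => ?_
  refine mul_le_mul_of_nonneg_left ?_ (mul_nonneg (hy i) (hy j))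
  rw [SimpleGraph.adjMatrix_apply]
  by_cases hij : i = j
  · subst hij
    by_cases h1 : i = a
    · simp [h1, hab]
    · by_cases h2 : i = b <;> simp [h1, h2]
      simp [hab.symm]
  · by_cases h1 : i = a
    · subst h1
      by_cases h2 : j = b
      · subst h2; simp [hab, h]
      · simp only [hij, h2, hab, if_true, if_false, sub_zero]
        split_ifs <;> norm_num
    · by_cases h2 : i = b
      · subst h2
        by_cases h3 : j = a
        · subst h3
          have : ¬ G.Adj i j := fun h' => h h'.symm
          simp [hij, this]
        · simp only [hij, h1, h3, if_true, if_false, sub_zero]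
          split_ifs <;> norm_num
      · simp only [hij, h1, h2, if_false, sub_zero]
        split_ifs <;> norm_num

omit [DecidableEq V] in
theorem sum_eq_sum_of_support {F : Finset V} {x : V → ℝ} (hx : ∀ j ∉ F, x j = 0) :
    ∑ i, x i = ∑ i ∈ F, x i :=
  (Finset.sum_subset (Finset.subset_univ F) fun j _ hj => hx j hj).symm

omit [DecidableEq V] in
theorem dotProduct_self_of_support {F : Finset V} {x : V → ℝ} (hx : ∀ j ∉ F, x j = 0) :
    x ⬝ᵥ x = ∑ i ∈ F, x i ^ 2 := by
  rw [← sum_eq_sum_of_support (x := fun i => x i ^ 2) fun j hj => by simp [hx j hj]]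
  exact Finset.sum_congr rfl fun i _ => (sq _).symm

theorem adjMatrix_form_le_card_sub_one {F : Finset V} {x : V → ℝ} (hx : ∀ j ∉ F, x j = 0) :
    x ⬝ᵥ G.adjMatrix ℝ *ᵥ x ≤ (F.card - 1) * (x ⬝ᵥ x) := by
  have hx' : ∀ j ∉ F, |x| j = 0 := fun j hj => by simp [hx j hj]
  refine (le_abs_self _).trans ((adjMatrix_form_abs G x).trans ?_)
  refine (adjMatrix_form_le_of_nonneg G (y := |x|) fun i => abs_nonneg _).trans ?_
  have h1 := sq_sum_le_card_mul_sum_sq (s := F) (f := |x|)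
  rw [← sum_eq_sum_of_support hx', ← dotProduct_self_of_support hx'] at h1
  rw [dotProduct_abs_self] at *
  linarith

/-- On a set of `l + 1` vertices that is not a clique, the adjacency form stays below `l` by a
definite amount. -/
theorem adjMatrix_form_le_of_not_clique {l : ℕ} (hl : 1 ≤ l) {F : Finset V}
    (hF : F.card ≤ l + 1) {a b : V} (ha : a ∈ F) (hb : b ∈ F) (hab : a ≠ b) (h : ¬ G.Adj a b)
    {x : V → ℝ} (hx : ∀ j ∉ F, x j = 0) :
    x ⬝ᵥ G.adjMatrix ℝ *ᵥ x ≤ (l - 1 / (l + 1)) * (x ⬝ᵥ x) := by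
  have hx' : ∀ j ∉ F, |x| j = 0 := fun j hj => by simp [hx j hj]
  refine (le_abs_self _).trans ((adjMatrix_form_abs G x).trans ?_)
  refine (adjMatrix_form_le_of_not_adj G (y := |x|) (fun i => abs_nonneg _) hab h).trans ?_
  rw [← dotProduct_abs_self x, sum_eq_sum_of_support hx', dotProduct_self_of_support hx']
  have hb' : b ∈ F.erase a := Finset.mem_erase.2 ⟨hab.symm, hb⟩
  rw [← Finset.add_sum_erase F _ ha, ← Finset.add_sum_erase (F.erase a) _ hb',
    ← Finset.add_sum_erase F _ ha, ← Finset.add_sum_erase (F.erase a) _ hb']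
  have h1 := sq_sum_le_card_mul_sum_sq (s := (F.erase a).erase b) (f := |x|)
  have h2 : (((F.erase a).erase b).card : ℝ) ≤ l - 1 := by
    rw [Finset.card_erase_of_mem hb', Finset.card_erase_of_mem ha]
    have : F.card - 1 - 1 ≤ l - 1 := by omega
    calc ((F.card - 1 - 1 : ℕ) : ℝ) ≤ ((l - 1 : ℕ) : ℝ) := by exact_mod_cast this
      _ = l - 1 := by rw [Nat.cast_sub hl]; simp
  set s := ∑ i ∈ (F.erase a).erase b, |x| i
  set Q := ∑ i ∈ (F.erase a).erase b, |x| i ^ 2 with hQ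
  have hQ0 : 0 ≤ Q := Finset.sum_nonneg fun i _ => sq_nonneg _
  set p := |x| a
  set q := |x| b
  have hl' : (1 : ℝ) ≤ l := by exact_mod_cast hl
  set η : ℝ := 1 / (l + 1) with hη
  have hη1 : η * (l + 1) = 1 := by rw [hη]; field_simp
  have hη0 : 0 < η := by positivity
  have hη2 : η ≤ 1 / 2 := by nlinarith
  have hs : s ^ 2 ≤ (l - 1) * Q := h1.trans (mul_le_mul_of_nonneg_right h2 hQ0)
  -- Weighted AM-GM for `2 * (p + q) * s`, with the weight that balances the two blocks.
  set c : ℝ := (l - η) / 2 with hc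
  have hc0 : 0 < c := by linarith
  have e1 : 2 * (p + q) * s ≤ c * (2 * (p ^ 2 + q ^ 2)) + s ^ 2 / c := by
    have e2 : 2 * (p + q) * s ≤ c * (p + q) ^ 2 + s ^ 2 / c := by
      have : c * (p + q) ^ 2 + s ^ 2 / c - 2 * (p + q) * s = (c * (p + q) - s) ^ 2 / c := by
        field_simp; ring
      have h3 : 0 ≤ (c * (p + q) - s) ^ 2 / c := by positivity
      linarith
    have e3 : (p + q) ^ 2 ≤ 2 * (p ^ 2 + q ^ 2) := by nlinarith [sq_nonneg (p - q)]
    have := mul_le_mul_of_nonneg_left e3 hc0.le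
    linarith
  have e4 : s ^ 2 + s ^ 2 / c ≤ (l + 1 - η) * Q := by
    have e5 : s ^ 2 + s ^ 2 / c ≤ ((l - 1) * Q) * (1 + 1 / c) := by
      have : s ^ 2 + s ^ 2 / c = s ^ 2 * (1 + 1 / c) := by ring
      rw [this]
      exact mul_le_mul_of_nonneg_right hs (by positivity)
    refine e5.trans ?_
    have e6 : (l - 1) * (1 + 1 / c) ≤ l + 1 - η := by
      have : (l - 1) * (1 + 1 / c) = (l - 1) * (c + 1) / c := by field_simp
      rw [this, div_le_iff₀ hc0, hc]
      nlinarith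
    calc (l - 1) * Q * (1 + 1 / c) = ((l - 1) * (1 + 1 / c)) * Q := by ring
      _ ≤ _ := mul_le_mul_of_nonneg_right e6 hQ0
  have e7 : c * (2 * (p ^ 2 + q ^ 2)) = (l - η) * (p ^ 2 + q ^ 2) := by rw [hc]; ring
  rw [e7] at e1
  linarith

/-- The eigenspace of the adjacency matrix for the eigenvalue `lam`. -/
noncomputable def adjEigenspace (lam : ℝ) : Submodule ℝ (EuclideanSpace ℝ V) where
  carrier := {x | G.adjMatrix ℝ *ᵥ x.ofLp = lam • x.ofLp}
  add_mem' := fun {x y} hx hy => by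
    simp only [Set.mem_ofPred_eq, WithLp.ofLp_add, mulVec_add, smul_add] at *
    rw [hx, hy]
  zero_mem' := by simp
  smul_mem' := fun c x hx => by
    simp only [Set.mem_ofPred_eq, WithLp.ofLp_smul, mulVec_smul] at *
    rw [hx, smul_comm]

end Forms

/-! ### Linear dependencies of an equiangular family -/

section Dependencies

open Matrix Module
open scoped InnerProductSpace

variable {V E : Type*} [Fintype V] [DecidableEq V] [NormedAddCommGroup E] [InnerProductSpace ℝ E]
  {lam : ℝ} {v : V → E}

/-- The space of linear dependencies of a family of vectors. -/
noncomputable def dependencySpace (v : V → E) : Submodule ℝ (EuclideanSpace ℝ V) :=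
  LinearMap.ker ((Fintype.linearCombination ℝ v).comp (WithLp.linearEquiv 2 ℝ (V → ℝ)).toLinearMap)

omit [DecidableEq V] in
theorem mem_dependencySpace {x : EuclideanSpace ℝ V} :
    x ∈ dependencySpace v ↔ ∑ i, x.ofLp i • v i = 0 := by
  simp [dependencySpace, Fintype.linearCombination_apply]

omit [DecidableEq V] in
theorem card_le_finrank_dependencySpace [FiniteDimensional ℝ E] (v : V → E) :
    Fintype.card V ≤ finrank ℝ E + finrank ℝ (dependencySpace v) := by
  let φ : EuclideanSpace ℝ V →ₗ[ℝ] E :=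
    (Fintype.linearCombination ℝ v).comp (WithLp.linearEquiv 2 ℝ (V → ℝ)).toLinearMap
  have h : finrank ℝ (LinearMap.range φ) + finrank ℝ (dependencySpace v) = _ :=
    LinearMap.finrank_range_add_finrank_ker φ
  rw [finrank_euclideanSpace] at h
  have h2 := Submodule.finrank_le (LinearMap.range φ)
  omega

namespace IsEquiangularFamily

variable [DecidableRel (negGraph v).Adj]

omit [Fintype V] in
theorem inner_eq (hv : IsEquiangularFamily lam v) (i j : V) :
    ⟪v i, v j⟫_ℝ = lam * (if i = j then 1 else 0) - (negGraph v).adjMatrix ℝ i j + 1 / 2 := by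
  rw [SimpleGraph.adjMatrix_apply]
  by_cases hij : i = j
  · subst hij; rw [hv.inner_self]; simp
  · by_cases h : (negGraph v).Adj i j
    · rw [hv.inner_of_adj h]; simp [hij, h]; norm_num
    · rw [hv.inner_of_not_adj hij h]; simp [hij, h]

theorem inner_sum_smul (hv : IsEquiangularFamily lam v) (x : V → ℝ) (i : V) :
    ⟪v i, ∑ j, x j • v j⟫_ℝ =
      lam * x i - ((negGraph v).adjMatrix ℝ *ᵥ x) i + (∑ j, x j) / 2 := by
  rw [inner_sum]
  simp only [inner_smul_right, hv.inner_eq, mul_add, mul_sub, Finset.sum_add_distrib,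
    Finset.sum_sub_distrib, mulVec, dotProduct]
  congr 1
  · congr 1
    · simp; ring
    · exact Finset.sum_congr rfl fun j _ => mul_comm _ _
  · rw [Finset.sum_div]; exact Finset.sum_congr rfl fun j _ => by ring

theorem form_nonneg (hv : IsEquiangularFamily lam v) (x : V → ℝ) :
    x ⬝ᵥ (negGraph v).adjMatrix ℝ *ᵥ x ≤ lam * (x ⬝ᵥ x) + (∑ j, x j) ^ 2 / 2 := by
  have h0 : 0 ≤ ⟪∑ i, x i • v i, ∑ j, x j • v j⟫_ℝ := real_inner_self_nonneg
  rw [sum_inner] at h0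
  simp only [inner_smul_left, hv.inner_sum_smul, conj_trivial] at h0
  have : ∑ i, x i * (lam * x i - ((negGraph v).adjMatrix ℝ *ᵥ x) i + (∑ j, x j) / 2) =
      lam * (x ⬝ᵥ x) - x ⬝ᵥ (negGraph v).adjMatrix ℝ *ᵥ x + (∑ j, x j) ^ 2 / 2 := by
    simp only [mul_add, mul_sub, Finset.sum_add_distrib, Finset.sum_sub_distrib,
      ← Finset.sum_mul]
    simp only [dotProduct, Finset.mul_sum]
    congr 1
    · congr 1
      exact Finset.sum_congr rfl fun j _ => by ring
    · ring
  linarith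

/-- A dependency is an eigenvector up to a constant vector. -/
theorem mulVec_of_mem_dependencySpace (hv : IsEquiangularFamily lam v) {x : EuclideanSpace ℝ V}
    (hx : x ∈ dependencySpace v) :
    (negGraph v).adjMatrix ℝ *ᵥ x.ofLp = fun i => lam * x.ofLp i + (∑ j, x.ofLp j) / 2 := by
  funext i
  have h := hv.inner_sum_smul x.ofLp i
  rw [mem_dependencySpace.1 hx, inner_zero_right] at h
  linarith

/-- Vectors with nonadjacent supports cannot both violate the bound `lam` on the adjacency form:
a combination of coordinate sum zero would violate positivity of the Gram matrix. -/
theorem false_of_two_large (hv : IsEquiangularFamily lam v) {x y : V → ℝ}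
    (hx : lam * (x ⬝ᵥ x) < x ⬝ᵥ (negGraph v).adjMatrix ℝ *ᵥ x)
    (hy : lam * (y ⬝ᵥ y) ≤ y ⬝ᵥ (negGraph v).adjMatrix ℝ *ᵥ y) (hsum : ∑ i, y i ≠ 0)
    (hxy : ∀ i j, x i ≠ 0 → y j ≠ 0 → i ≠ j ∧ ¬ (negGraph v).Adj i j) : False := by
  have h1 : x ⬝ᵥ y = 0 := by
    refine Finset.sum_eq_zero fun i _ => ?_
    by_contra h
    exact (hxy i i (left_ne_zero_of_mul h) (right_ne_zero_of_mul h)).1 rfl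
  have h2 : x ⬝ᵥ (negGraph v).adjMatrix ℝ *ᵥ y = 0 := by
    refine Finset.sum_eq_zero fun i _ => ?_
    by_cases hxi : x i = 0
    · simp [hxi]
    · rw [mul_eq_zero]; right
      refine Finset.sum_eq_zero fun j _ => ?_
      by_cases hyj : y j = 0
      · simp [hyj]
      · simp [SimpleGraph.adjMatrix_apply, (hxy i j hxi hyj).2]
  have h3 : y ⬝ᵥ (negGraph v).adjMatrix ℝ *ᵥ x = 0 := by
    rw [dotProduct_mulVec, ← mulVec_transpose, SimpleGraph.transpose_adjMatrix, dotProduct_comm, h2]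
  have h4 := hv.form_nonneg ((∑ i, y i) • x - (∑ i, x i) • y)
  simp only [mulVec_sub, mulVec_smul, dotProduct_sub, sub_dotProduct, dotProduct_smul,
    smul_dotProduct, h1, h2, h3, dotProduct_comm y x, smul_eq_mul, Pi.sub_apply, Pi.smul_apply,
    Finset.sum_sub_distrib, ← Finset.mul_sum] at h4
  have h5 : 0 < (∑ i, y i) ^ 2 := by positivity
  nlinarith [mul_lt_mul_of_pos_left hx h5, mul_le_mul_of_nonneg_left hy (sq_nonneg (∑ i, x i))]

/-- The Gram form is nonnegative, so the bound `lam` on the adjacency form holds on the hyperplane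
of coordinate sum zero. -/
theorem sum_ne_zero_of_large (hv : IsEquiangularFamily lam v) {x : V → ℝ}
    (hx : lam * (x ⬝ᵥ x) < x ⬝ᵥ (negGraph v).adjMatrix ℝ *ᵥ x) : ∑ i, x i ≠ 0 := by
  intro h
  have := hv.form_nonneg x
  rw [h] at this
  linarith

end IsEquiangularFamily

end Dependencies

/-! ### The number of linear dependencies -/

section CardBound

open Matrix Module

variable {V E : Type*} [Fintype V] [DecidableEq V] [NormedAddCommGroup E] [InnerProductSpace ℝ E]
  {v : V → E} {l : ℕ} [DecidableRel (negGraph v).Adj]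

theorem le_of_forall_even_pow {a b C ρ : ℝ} (hρ0 : 0 ≤ ρ) (hρ1 : ρ < 1)
    (h : ∀ m : ℕ, a ≤ b + C * (ρ ^ 2) ^ (m + 1)) : a ≤ b := by
  have h1 : Filter.Tendsto (fun m : ℕ => b + C * (ρ ^ 2) ^ (m + 1)) Filter.atTop
      (nhds (b + C * 0)) :=
    (((tendsto_pow_atTop_nhds_zero_of_lt_one (sq_nonneg ρ)
      (pow_lt_one₀ hρ0 hρ1 two_ne_zero)).comp (Filter.tendsto_add_atTop_nat 1)).const_mul C
      ).const_add b
  rw [mul_zero, add_zero] at h1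
  exact ge_of_tendsto' h1 h

/-- If the adjacency form never exceeds `l`, the eigenvalue `l` has multiplicity at most
`#V / (l + 1)`. -/
theorem finrank_adjEigenspace_le_of_form_le (G : SimpleGraph V) [DecidableRel G.Adj] (hl : 1 ≤ l)
    (h : ∀ x : V → ℝ, x ⬝ᵥ G.adjMatrix ℝ *ᵥ x ≤ l * (x ⬝ᵥ x)) :
    (l + 1) * finrank ℝ (adjEigenspace G (l : ℝ)) ≤ Fintype.card V := by
  have hl' : (1 : ℝ) ≤ l := by exact_mod_cast hl
  have h2l : (0 : ℝ) < 2 * l := by linarith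
  set d := finrank ℝ (adjEigenspace G (l : ℝ))
  have key : ((l : ℝ) + 1) * d ≤ Fintype.card V := by
    refine le_of_forall_even_pow (C := (l + 1) * (Fintype.card V *
      ((Fintype.card V : ℕ) + 1) ^ (l * l) * l)) (ρ := (2 * l - 1) / (2 * l))
      (div_nonneg (by linarith) h2l.le) ((div_lt_one h2l).2 (by linarith)) fun m => ?_
    have h1 := finrank_eigenspace_le (G := G) (D := Fintype.card V) (lam := l) (ε := 1) (h := l)
      (p := 2 * (m + 1)) (fun v => (G.degree_lt_card_verts v).le)
      (by linarith) zero_le_one (by linarith) (by omega) (even_two_mul _)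
      (fun i x _ => h x)
      (fun F hF x hx => (adjMatrix_form_le_card_sub_one G hx).trans
        (mul_le_mul_of_nonneg_right (sub_le_sub_right (by exact_mod_cast hF) 1)
          (Finset.sum_nonneg fun i _ => mul_self_nonneg _)))
      (adjEigenspace G (l : ℝ)) (fun x hx => hx)
    rw [← pow_mul, div_pow]
    have hpos : (0 : ℝ) < (2 * l) ^ (2 * (m + 1)) := by positivity
    rw [← sub_nonneg] at h1 ⊢
    refine nonneg_of_mul_nonneg_left (h1.trans (le_of_eq ?_)) hpos
    field_simp
    ring
  exact_mod_cast key

/-- If the adjacency form is bounded by `lam`, every vector attaining the bound is an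
eigenvector. -/
theorem mem_adjEigenspace_of_form_eq (G : SimpleGraph V) [DecidableRel G.Adj] {lam : ℝ}
    (h : ∀ x : V → ℝ, x ⬝ᵥ G.adjMatrix ℝ *ᵥ x ≤ lam * (x ⬝ᵥ x)) {x : V → ℝ}
    (hx : lam * (x ⬝ᵥ x) ≤ x ⬝ᵥ G.adjMatrix ℝ *ᵥ x) : G.adjMatrix ℝ *ᵥ x = lam • x := by
  have hpsd : (lam • (1 : Matrix V V ℝ) - G.adjMatrix ℝ).PosSemidef := by
    refine PosSemidef.of_dotProduct_mulVec_nonneg ?_ fun y => ?_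
    · ext i j
      simp [SimpleGraph.adjMatrix_apply, Matrix.one_apply, SimpleGraph.adj_comm, eq_comm]
    · have := h y
      simp only [star_trivial, sub_mulVec, smul_mulVec, one_mulVec, dotProduct_sub,
        dotProduct_smul, smul_eq_mul]
      linarith
  have h2 := (hpsd.dotProduct_mulVec_zero_iff x).1 (by
    have := h x
    simp only [star_trivial, sub_mulVec, smul_mulVec, one_mulVec, dotProduct_sub,
      dotProduct_smul, smul_eq_mul]
    linarith)
  rw [sub_mulVec, smul_mulVec, one_mulVec, sub_eq_zero] at h2
  exact h2.symm

namespace IsEquiangularFamily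

/-- The case in which the negative graph has spectral radius at most `l`. Dependencies are then
`l`-eigenvectors of coordinate sum zero; the absolute value of one of them is an `l`-eigenvector
that is not a dependency. -/
theorem finrank_dependencySpace_of_form_le (hv : IsEquiangularFamily (l : ℝ) v) (hl : 1 ≤ l)
    (h : ∀ x : V → ℝ, x ⬝ᵥ (negGraph v).adjMatrix ℝ *ᵥ x ≤ l * (x ⬝ᵥ x))
    (hpos : 0 < finrank ℝ (dependencySpace v)) :
    (l + 1) * (finrank ℝ (dependencySpace v) + 1) ≤ Fintype.card V := by
  have hsum : ∀ x ∈ dependencySpace v, ∑ i, x.ofLp i = 0 := by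
    intro x hx
    have h1 := h x.ofLp
    have h2 : x.ofLp ⬝ᵥ (negGraph v).adjMatrix ℝ *ᵥ x.ofLp =
        l * (x.ofLp ⬝ᵥ x.ofLp) + (∑ i, x.ofLp i) ^ 2 / 2 := by
      rw [hv.mulVec_of_mem_dependencySpace hx]
      simp only [dotProduct, mul_add, Finset.sum_add_distrib, ← Finset.sum_mul, Finset.mul_sum]
      congr 1
      · exact Finset.sum_congr rfl fun i _ => by ring
      · ring
    have h3 : (∑ i, x.ofLp i) ^ 2 = 0 := le_antisymm (by linarith) (sq_nonneg _)
    exact pow_eq_zero_iff two_ne_zero |>.1 h3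
  have hle : dependencySpace v ≤ adjEigenspace (negGraph v) (l : ℝ) := by
    intro x hx
    change (negGraph v).adjMatrix ℝ *ᵥ x.ofLp = (l : ℝ) • x.ofLp
    rw [hv.mulVec_of_mem_dependencySpace hx, hsum x hx]
    funext i
    simp
  obtain ⟨⟨x, hx⟩, hx0⟩ := finrank_pos_iff_exists_ne_zero.1 hpos
  have hx0' : x.ofLp ≠ 0 := fun h => hx0 (by ext i; simpa using congrFun h i)
  have habs : WithLp.toLp 2 |x.ofLp| ∈ adjEigenspace (negGraph v) (l : ℝ) := by
    refine mem_adjEigenspace_of_form_eq _ h ?_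
    change _ ≤ |x.ofLp| ⬝ᵥ _ *ᵥ |x.ofLp|
    refine le_trans ?_ ((le_abs_self _).trans (adjMatrix_form_abs (negGraph v) x.ofLp))
    have h4 : (negGraph v).adjMatrix ℝ *ᵥ x.ofLp = (l : ℝ) • x.ofLp := hle hx
    rw [h4, dotProduct_smul, smul_eq_mul]
    exact le_of_eq (congrArg _ (dotProduct_abs_self _))
  have hnot : WithLp.toLp 2 |x.ofLp| ∉ dependencySpace v := by
    intro hmem
    have h5 : ∑ i, |x.ofLp i| = 0 := hsum _ hmem
    rw [Finset.sum_eq_zero_iff_of_nonneg fun i _ => abs_nonneg _] at h5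
    exact hx0' (funext fun i => by simpa using h5 i (Finset.mem_univ i))
  have hlt : finrank ℝ (dependencySpace v) < finrank ℝ (adjEigenspace (negGraph v) (l : ℝ)) :=
    Submodule.finrank_lt_finrank_of_lt (lt_of_le_of_ne hle fun he => hnot (he ▸ habs))
  exact (Nat.mul_le_mul_left _ hlt).trans
    (finrank_adjEigenspace_le_of_form_le (negGraph v) hl h)

end IsEquiangularFamily

/-- The graph `G` without the edges that meet `U`. -/
def isolateVertices (G : SimpleGraph V) (U : Finset V) : SimpleGraph V where
  Adj i j := G.Adj i j ∧ i ∉ U ∧ j ∉ U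
  symm := ⟨fun _ _ h => ⟨h.1.symm, h.2.2, h.2.1⟩⟩
  loopless := ⟨fun _ h => h.1.ne rfl⟩

omit [DecidableEq V] in
theorem form_mono {G H : SimpleGraph V} [DecidableRel G.Adj] [DecidableRel H.Adj] (hHG : H ≤ G)
    {x : V → ℝ} (hx : ∀ i, 0 ≤ x i) :
    x ⬝ᵥ H.adjMatrix ℝ *ᵥ x ≤ x ⬝ᵥ G.adjMatrix ℝ *ᵥ x := by
  rw [adjMatrix_form_eq_sum, adjMatrix_form_eq_sum]
  refine Finset.sum_le_sum fun i _ => Finset.sum_le_sum fun j _ => ?_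
  refine mul_le_mul_of_nonneg_left ?_ (mul_nonneg (hx i) (hx j))
  simp only [SimpleGraph.adjMatrix_apply]
  by_cases h : H.Adj i j
  · simp [h, hHG h]
  · simp only [h, if_false]; split_ifs <;> norm_num

omit [DecidableEq V] in
theorem ballFinset_isolateVertices_of_mem (G : SimpleGraph V) {U : Finset V} {i : V} (hi : i ∈ U)
    (t : ℕ) : (isolateVertices G U).ballFinset t i ⊆ {i} := by
  intro j hj
  rw [SimpleGraph.mem_ballFinset] at hj
  obtain ⟨W, -⟩ := SimpleGraph.exists_walk_of_edist_ne_top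
    (ne_top_of_le_ne_top (ENat.natCast_ne_top _) hj)
  cases W with
  | nil => simp
  | cons hadj _ => exact absurd hi hadj.2.1

omit [DecidableEq V] in
theorem ballFinset_mono {G H : SimpleGraph V} (hHG : H ≤ G) (t : ℕ) (i : V) :
    H.ballFinset t i ⊆ G.ballFinset t i := fun j hj => by
  rw [SimpleGraph.mem_ballFinset] at *
  exact (SimpleGraph.edist_anti hHG).trans hj

/-- The adjacency form splits along a set of vertices without edges to its complement. -/
theorem form_split (G : SimpleGraph V) [DecidableRel G.Adj] {F : Finset V}
    (hF : ∀ i ∈ F, ∀ j ∉ F, ¬ G.Adj i j) (z : V → ℝ) :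
    z ⬝ᵥ G.adjMatrix ℝ *ᵥ z =
      (fun i => if i ∈ F then z i else 0) ⬝ᵥ G.adjMatrix ℝ *ᵥ (fun i => if i ∈ F then z i else 0) +
      (fun i => if i ∈ F then 0 else z i) ⬝ᵥ G.adjMatrix ℝ *ᵥ
        (fun i => if i ∈ F then 0 else z i) := by
  simp only [adjMatrix_form_eq_sum, ← Finset.sum_add_distrib]
  refine Finset.sum_congr rfl fun i _ => Finset.sum_congr rfl fun j _ => ?_
  by_cases hi : i ∈ F <;> by_cases hj : j ∈ F <;> simp [hi, hj, SimpleGraph.adjMatrix_apply]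
  · exact fun h => absurd h (hF i hi j hj)
  · exact fun h => absurd h.symm (hF j hj i hi)

theorem form_indicator_clique (G : SimpleGraph V) [DecidableRel G.Adj] {F : Finset V}
    (hF : (F : Set V).Pairwise G.Adj) :
    (fun i => if i ∈ F then (1 : ℝ) else 0) ⬝ᵥ G.adjMatrix ℝ *ᵥ (fun i => if i ∈ F then 1 else 0) =
      F.card * (F.card - 1) := by
  have h1 : ∀ i ∈ F, (G.adjMatrix ℝ *ᵥ fun i => if i ∈ F then (1 : ℝ) else 0) i = F.card - 1 := by
    intro i hi
    simp only [mulVec, dotProduct, mul_ite, mul_one, mul_zero, Finset.sum_ite_mem,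
      Finset.univ_inter]
    rw [← Finset.add_sum_erase _ _ hi, Finset.sum_congr rfl (g := fun _ => (1 : ℝ)) fun j hj => by
      simp [SimpleGraph.adjMatrix_apply, hF hi (Finset.mem_of_mem_erase hj)
        (Finset.ne_of_mem_erase hj).symm]]
    simp [Finset.card_erase_of_mem hi, Nat.cast_sub (Finset.card_pos.2 ⟨i, hi⟩)]
  rw [dotProduct]
  simp only [ite_mul, one_mul, zero_mul, Finset.sum_ite_mem, Finset.univ_inter]
  rw [Finset.sum_congr rfl h1, Finset.sum_const, nsmul_eq_mul]

/-- A clique on `l + 1` vertices together with a further neighbour has spectral radius above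
`l`. -/
theorem exists_large_of_clique_of_adj (G : SimpleGraph V) [DecidableRel G.Adj] (hl : 1 ≤ l)
    {F : Finset V} (hF : (F : Set V).Pairwise G.Adj) (hc : F.card = l + 1) {i y : V} (hi : i ∈ F)
    (hy : y ∉ F) (hiy : G.Adj i y) :
    ∃ x : V → ℝ, (∀ j, x j ≠ 0 → j ∈ F ∨ j = y) ∧
      l * (x ⬝ᵥ x) < x ⬝ᵥ G.adjMatrix ℝ *ᵥ x := by
  have hl' : (1 : ℝ) ≤ l := by exact_mod_cast hl
  set f : V → ℝ := fun i => if i ∈ F then 1 else 0 with hf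
  set e : V → ℝ := Pi.single y 1 with he
  have hff : f ⬝ᵥ f = l + 1 := by simp [hf, dotProduct, hc]
  have hfe : f ⬝ᵥ e = 0 := by simp [hf, he, hy]
  have hee : e ⬝ᵥ e = 1 := by simp [he]
  have hAff : f ⬝ᵥ G.adjMatrix ℝ *ᵥ f = (l + 1) * l := by
    rw [hf, form_indicator_clique G hF, hc]; push_cast; ring
  have hAee : e ⬝ᵥ G.adjMatrix ℝ *ᵥ e = 0 := by simp [he, SimpleGraph.adjMatrix_apply]
  have hAef : 1 ≤ e ⬝ᵥ G.adjMatrix ℝ *ᵥ f := by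
    have : e ⬝ᵥ G.adjMatrix ℝ *ᵥ f = ∑ j ∈ F, G.adjMatrix ℝ y j := by
      rw [he, single_one_dotProduct]
      simp [hf, mulVec, dotProduct]
    rw [this]
    have h1 : (1 : ℝ) = G.adjMatrix ℝ y i := by simp [SimpleGraph.adjMatrix_apply, hiy.symm]
    rw [h1]
    exact Finset.single_le_sum (f := fun j => G.adjMatrix ℝ y j)
      (fun j _ => by rw [SimpleGraph.adjMatrix_apply]; split_ifs <;> norm_num) hi
  have hAfe : f ⬝ᵥ G.adjMatrix ℝ *ᵥ e = e ⬝ᵥ G.adjMatrix ℝ *ᵥ f := by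
    rw [dotProduct_mulVec, ← mulVec_transpose, SimpleGraph.transpose_adjMatrix, dotProduct_comm]
  refine ⟨f + (1 / l : ℝ) • e, fun j hj => ?_, ?_⟩
  · by_contra hcon
    push Not at hcon
    exact hj (by simp [hf, he, hcon.1, hcon.2])
  · simp only [mulVec_add, mulVec_smul, dotProduct_add, add_dotProduct, dotProduct_smul,
      smul_dotProduct, hff, hfe, hee, hAff, hAee, hAfe, dotProduct_comm e f, smul_eq_mul]
    have h2 : (l : ℝ) * (1 / l * (1 / l * 1)) = 1 / l := by field_simp
    have h3 : (0 : ℝ) < 1 / l := by positivity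
    have h4 := mul_le_mul_of_nonneg_left hAef h3.le
    nlinarith

namespace IsEquiangularFamily

/-- The case in which the negative graph has spectral radius above `l`. All balls of radius `p`
with spectral radius above `l` meet or are adjacent, so their centres `U` are few. Isolating `U`
leaves a graph to which the multiplicity bound applies with `h = l + 1`: a clique on `l + 1`
vertices in it would be a connected component of the negative graph. -/
theorem finrank_dependencySpace_of_large (hv : IsEquiangularFamily (l : ℝ) v) (hl : 1 ≤ l)
    {D p : ℕ} (hD : ∀ i, (negGraph v).degree i ≤ D) (hp : p ≠ 0) (hpe : Even p) {z : V → ℝ}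
    (hz : l * (z ⬝ᵥ z) < z ⬝ᵥ (negGraph v).adjMatrix ℝ *ᵥ z) :
    ∃ d : ℕ, finrank ℝ (dependencySpace v) ≤ d + (D + 1) ^ (2 * p + 1) + 1 ∧
      ((l : ℝ) + 2) * (d * (2 * l) ^ p) ≤ Fintype.card V * (2 * l) ^ p +
        (l + 2) * (Fintype.card V * (D + 1) ^ ((l + 1) * (l + 1)) * (l + 1) *
          (2 * l - 1 / (l + 1)) ^ p) := by
  classical
  have hl' : (1 : ℝ) ≤ l := by exact_mod_cast hl
  set U : Finset V := Finset.univ.filter fun i => ∃ x : V → ℝ,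
    (∀ j ∉ (negGraph v).ballFinset p i, x j = 0) ∧
      l * (x ⬝ᵥ x) < x ⬝ᵥ (negGraph v).adjMatrix ℝ *ᵥ x with hU
  have hUcard : U.card ≤ (D + 1) ^ (2 * p + 1) := by
    rcases U.eq_empty_or_nonempty with h | ⟨u, hu⟩
    · simp [h]
    refine (Finset.card_le_card fun w hw => ?_).trans
      ((negGraph v).card_ballFinset_le hD (2 * p + 1) u)
    by_contra hfar
    rw [SimpleGraph.mem_ballFinset] at hfar
    obtain ⟨x, hx, hxl⟩ := (Finset.mem_filter.1 hu).2
    obtain ⟨y, hy, hyl⟩ := (Finset.mem_filter.1 hw).2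
    refine hv.false_of_two_large hxl hyl.le (hv.sum_ne_zero_of_large hyl) fun i j hi hj => ?_
    have hi' : (negGraph v).edist u i ≤ p :=
      SimpleGraph.mem_ballFinset.1 (by_contra fun h => hi (hx i h))
    have hj' : (negGraph v).edist w j ≤ p :=
      SimpleGraph.mem_ballFinset.1 (by_contra fun h => hj (hy j h))
    have hij : ¬ (negGraph v).edist i j ≤ 1 := by
      intro hij
      apply hfar
      calc (negGraph v).edist u w ≤ (negGraph v).edist u i + (negGraph v).edist i w :=
            SimpleGraph.edist_triangle
        _ ≤ (negGraph v).edist u i + ((negGraph v).edist i j + (negGraph v).edist j w) := by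
          gcongr; exact SimpleGraph.edist_triangle
        _ ≤ p + (1 + p) := by
          rw [SimpleGraph.edist_comm (u := j)]
          gcongr
        _ = _ := by push_cast; ring
    constructor
    · rintro rfl
      exact hij (by simp)
    · exact fun h => hij (SimpleGraph.edist_eq_one_iff_adj.2 h).le
  set H := isolateVertices (negGraph v) U with hH
  have hHG : H ≤ (negGraph v) := fun i j h => h.1
  have hHD : ∀ i, H.degree i ≤ D := fun i =>
    (SimpleGraph.degree_le_of_le hHG).trans (hD i)
  have ha : ∀ i, ∀ x : V → ℝ, (∀ j ∉ H.ballFinset p i, x j = 0) →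
      x ⬝ᵥ H.adjMatrix ℝ *ᵥ x ≤ l * (x ⬝ᵥ x) := by
    intro i x hx
    by_cases hi : i ∈ U
    · have h1 := adjMatrix_form_le_card_sub_one H (F := {i}) (x := x) fun j hj =>
        hx j fun h => hj (ballFinset_isolateVertices_of_mem (negGraph v) hi p h)
      have h2 : 0 ≤ x ⬝ᵥ x := Finset.sum_nonneg fun i _ => mul_self_nonneg _
      simp only [Finset.card_singleton, Nat.cast_one, sub_self, zero_mul] at h1
      exact h1.trans (by positivity)
    · have h1 : ∀ y : V → ℝ, (∀ j ∉ (negGraph v).ballFinset p i, y j = 0) →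
          y ⬝ᵥ (negGraph v).adjMatrix ℝ *ᵥ y ≤ l * (y ⬝ᵥ y) := by
        intro y hy
        by_contra hlt
        exact hi (Finset.mem_filter.2 ⟨Finset.mem_univ _, y, hy, not_le.1 hlt⟩)
      have h2 := h1 |x| fun j hj => by simp [hx j fun h => hj (ballFinset_mono hHG p i h)]
      rw [dotProduct_abs_self] at h2
      exact (le_abs_self _).trans ((adjMatrix_form_abs H x).trans
        ((form_mono hHG (x := |x|) fun j => abs_nonneg _).trans h2))
  have hclique : ∀ F : Finset V, F.card = l + 1 → ¬ (F : Set V).Pairwise H.Adj := by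
    intro F hc hF
    have hFG : (F : Set V).Pairwise (negGraph v).Adj := fun i hi j hj hij => hHG (hF hi hj hij)
    have hFU : ∀ i ∈ F, i ∉ U := by
      intro i hi
      obtain ⟨j, hj, hji⟩ := Finset.exists_mem_ne (by omega : 1 < F.card) i
      exact (hF hi hj hji.symm).2.1
    by_cases hout : ∃ i ∈ F, ∃ y ∉ F, (negGraph v).Adj i y
    · obtain ⟨i, hi, y, hy, hiy⟩ := hout
      obtain ⟨x, hx, hxl⟩ := exists_large_of_clique_of_adj (negGraph v) hl hFG hc hi hy hiy
      refine hFU i hi (Finset.mem_filter.2 ⟨Finset.mem_univ _, x, fun j hj => ?_, hxl⟩)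
      by_contra hxj
      have hp1 : (1 : ℕ∞) ≤ p := by exact_mod_cast Nat.one_le_iff_ne_zero.2 hp
      refine hj (SimpleGraph.mem_ballFinset.2 (le_trans ?_ hp1))
      by_cases hij : i = j
      · simp [hij]
      · refine (SimpleGraph.edist_eq_one_iff_adj.2 ?_).le
        rcases hx j hxj with h | rfl
        · exact hFG hi h hij
        · exact hiy
    · push Not at hout
      -- The clique is a component: the part of `z` off the clique is still large.
      have h1 := form_split (negGraph v) hout z
      have h2 := adjMatrix_form_le_card_sub_one (negGraph v) (F := F)
        (x := fun i => if i ∈ F then z i else 0) fun j hj => by simp [hj]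
      rw [hc] at h2
      push_cast at h2
      rw [add_sub_cancel_right] at h2
      have h3 : z ⬝ᵥ z =
          (fun i => if i ∈ F then z i else 0) ⬝ᵥ (fun i => if i ∈ F then z i else 0) +
          (fun i => if i ∈ F then 0 else z i) ⬝ᵥ (fun i => if i ∈ F then 0 else z i) := by
        simp only [dotProduct, ← Finset.sum_add_distrib]
        exact Finset.sum_congr rfl fun i _ => by split_ifs <;> simp
      refine hv.false_of_two_large (x := fun i => if i ∈ F then 0 else z i)
        (y := fun i => if i ∈ F then 1 else 0) ?_ ?_ ?_ ?_
      · rw [h3, mul_add] at hz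
        linarith
      · rw [form_indicator_clique (negGraph v) hFG, hc]
        simp [dotProduct, hc]
        linarith
      · simp [hc]
        positivity
      · intro i j hi hj
        have hi' : i ∉ F := fun h => hi (by simp [h])
        have hj' : j ∈ F := by_contra fun h => hj (by simp [h])
        exact ⟨fun h => hi' (h ▸ hj'), fun h => hout j hj' i hi' h.symm⟩
  have hb : ∀ F : Finset V, F.card ≤ l + 1 → ∀ x : V → ℝ, (∀ j ∉ F, x j = 0) →
      x ⬝ᵥ H.adjMatrix ℝ *ᵥ x ≤ (l - 1 / (l + 1)) * (x ⬝ᵥ x) := by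
    intro F hF x hx
    by_cases hp : (F : Set V).Pairwise H.Adj
    · have hF' : F.card ≤ l := by
        have h0 : F.card ≠ l + 1 := fun h => hclique F h hp
        omega
      refine (adjMatrix_form_le_card_sub_one H hx).trans
        (mul_le_mul_of_nonneg_right ?_ (Finset.sum_nonneg fun i _ => mul_self_nonneg _))
      have h1 : (F.card : ℝ) ≤ l := by exact_mod_cast hF'
      have h2 : (1 : ℝ) / (l + 1) ≤ 1 := by
        rw [div_le_one (by positivity)]; linarith
      linarith
    · simp only [Set.Pairwise, not_forall] at hp
      obtain ⟨a, ha, b, hb, hab, hadj⟩ := hp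
      exact adjMatrix_form_le_of_not_clique H hl hF ha hb hab hadj hx
  refine ⟨finrank ℝ (adjEigenspace H (l : ℝ)), ?_, ?_⟩
  · -- Dependencies that vanish on `U` and have coordinate sum zero are eigenvectors of `H`.
    let ψ : dependencySpace v →ₗ[ℝ] (U → ℝ) × ℝ :=
      { toFun := fun x => (fun u => x.1.ofLp u.1, ∑ i, x.1.ofLp i)
        map_add' := fun x y => by ext <;> simp [Finset.sum_add_distrib]
        map_smul' := fun a x => by ext <;> simp [Finset.mul_sum] }
    have hψ := LinearMap.finrank_range_add_finrank_ker ψ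
    have h1 : finrank ℝ (LinearMap.range ψ) ≤ U.card + 1 := by
      refine (Submodule.finrank_le _).trans ?_
      simp
    have h2 : finrank ℝ (LinearMap.ker ψ) ≤ finrank ℝ (adjEigenspace H (l : ℝ)) := by
      let χ : LinearMap.ker ψ →ₗ[ℝ] adjEigenspace H (l : ℝ) :=
        ((dependencySpace v).subtype.comp (LinearMap.ker ψ).subtype).codRestrict _ (by
          rintro ⟨⟨x, hx⟩, hxψ⟩
          have hx1 : ∑ i, x.ofLp i = 0 := congrArg Prod.snd (LinearMap.mem_ker.1 hxψ)
          have hx2 : ∀ u ∈ U, x.ofLp u = 0 := fun u hu =>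
            congrFun (congrArg Prod.fst (LinearMap.mem_ker.1 hxψ)) ⟨u, hu⟩
          have hx3 := hv.mulVec_of_mem_dependencySpace hx
          change H.adjMatrix ℝ *ᵥ x.ofLp = (l : ℝ) • x.ofLp
          funext i
          by_cases hi : i ∈ U
          · simp [mulVec, dotProduct, SimpleGraph.adjMatrix_apply, hH, isolateVertices, hi,
              hx2 i hi]
          · have hx4 := congrFun hx3 i
            rw [hx1, zero_div, add_zero] at hx4
            rw [Pi.smul_apply, smul_eq_mul, ← hx4]
            refine Finset.sum_congr rfl fun j _ => ?_
            by_cases hj : j ∈ U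
            · simp [hx2 j hj]
            · simp [SimpleGraph.adjMatrix_apply, hH, isolateVertices, hi, hj])
      refine LinearMap.finrank_le_finrank_of_injective (f := χ) ?_
      intro x y hxy
      have := congrArg Subtype.val hxy
      exact Subtype.ext (Subtype.ext this)
    omega
  · have h2 : (1 : ℝ) / (l + 1) ≤ 1 := by
      rw [div_le_one (by positivity)]; linarith
    have h3 := finrank_eigenspace_le (G := H) hHD (by linarith : (0 : ℝ) ≤ l)
      (ε := 1 / (l + 1)) (h := l + 1) (p := p) (by positivity) (by linarith) hp hpe ha hb
      (adjEigenspace H (l : ℝ)) (fun x hx => hx)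
    push_cast at h3
    rw [show (l : ℝ) + 1 + 1 = l + 2 by ring] at h3
    exact h3

end IsEquiangularFamily

end CardBound

/-! ### The upper bound for large dimension -/

section UpperBound

open Matrix Module
open scoped InnerProductSpace

/-- The degree bound of the switched negative graph, in the form used in the estimates below. -/
theorem two_pow_degree_add_one_le {l : ℕ} (hl : 1 ≤ l) :
    2 ^ (2 * l + 3 + 3 * l ^ 2) + 1 ≤ 2 ^ (4 * (l + 1) ^ 2) := by
  calc 2 ^ (2 * l + 3 + 3 * l ^ 2) + 1 ≤ 2 ^ (2 * l + 3 + 3 * l ^ 2) * 2 := by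
        have := Nat.one_le_two_pow (n := 2 * l + 3 + 3 * l ^ 2)
        omega
    _ = 2 ^ (2 * l + 3 + 3 * l ^ 2 + 1) := (pow_succ _ _).symm
    _ ≤ _ := Nat.pow_le_pow_right two_pos (by nlinarith)

/-- The walk parameter `m` makes the weight of the walks on few vertices negligible. -/
theorem short_walk_bound {l B m : ℕ} (hB : B ≤ 2 ^ (4 * (l + 1) ^ 2))
    (hm : m = 4 * (l + 1) ^ 4 + 3 * (l + 1) + 2) :
    2 * ((l + 1) * (l + 2)) * (B ^ ((l + 1) * (l + 1)) * (l + 1)) ≤ 2 ^ m := by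
  have h1 : l + 1 ≤ 2 ^ (l + 1) := Nat.lt_two_pow_self.le
  have h2 : l + 2 ≤ 2 * 2 ^ (l + 1) := by omega
  calc 2 * ((l + 1) * (l + 2)) * (B ^ ((l + 1) * (l + 1)) * (l + 1))
      ≤ 2 * (2 ^ (l + 1) * (2 * 2 ^ (l + 1))) *
          ((2 ^ (4 * (l + 1) ^ 2)) ^ ((l + 1) * (l + 1)) * 2 ^ (l + 1)) := by gcongr
    _ = 2 ^ m := by
      rw [← pow_mul, hm]
      ring

/-- The dimension dominates the size of balls of radius `2 * p + 1`, where
`p = 2 * l * (l + 1) * m`. -/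
theorem ball_bound {l B m : ℕ} (hl : 1 ≤ l) (hB : B ≤ 2 ^ (4 * (l + 1) ^ 2))
    (hm : m = 4 * (l + 1) ^ 4 + 3 * (l + 1) + 2) :
    2 * ((l + 1) * (l + 2)) * (B ^ (2 * (2 * l * (l + 1) * m) + 1) + 2) ≤
      2 ^ ((l + 1) ^ 17) := by
  have h1 : l + 1 ≤ 2 ^ (l + 1) := Nat.lt_two_pow_self.le
  have h2 : l + 2 ≤ 2 * 2 ^ (l + 1) := by omega
  have h3 : B ^ (2 * (2 * l * (l + 1) * m) + 1) ≤
      2 ^ (4 * (l + 1) ^ 2 * (2 * (2 * l * (l + 1) * m) + 1)) := by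
    rw [pow_mul]; exact Nat.pow_le_pow_left hB _
  set e := 4 * (l + 1) ^ 2 * (2 * (2 * l * (l + 1) * m) + 1) with he
  have h4 : 2 ^ e + 2 ≤ 4 * 2 ^ e := by
    have := Nat.one_le_two_pow (n := e)
    omega
  calc 2 * ((l + 1) * (l + 2)) * (B ^ (2 * (2 * l * (l + 1) * m) + 1) + 2)
      ≤ 2 * (2 ^ (l + 1) * (2 * 2 ^ (l + 1))) * (4 * 2 ^ e) := by
        gcongr
        omega
    _ = 2 ^ (2 * (l + 1) + 4 + e) := by ring
    _ ≤ _ := by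
      refine Nat.pow_le_pow_right two_pos ?_
      set k := l + 1 with hk
      have hk2 : 2 ≤ k := by omega
      have he' : e ≤ 4 * k ^ 2 * (2 * (2 * k * k * m) + 1) := by
        rw [he]; gcongr; omega
      have e1 : k ≤ k ^ 8 := Nat.le_self_pow (by norm_num) k
      have e2 : k ^ 2 ≤ k ^ 8 := Nat.pow_le_pow_right (by omega) (by norm_num)
      have e4 : k ^ 4 ≤ k ^ 8 := Nat.pow_le_pow_right (by omega) (by norm_num)
      have e5 : k ^ 5 ≤ k ^ 8 := Nat.pow_le_pow_right (by omega) (by norm_num)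
      have e0 : 2 ^ 8 ≤ k ^ 8 := Nat.pow_le_pow_left hk2 8
      have e9 : 2 ^ 9 * k ^ 8 ≤ k ^ 17 := by
        rw [show k ^ 17 = k ^ 9 * k ^ 8 by ring]
        exact Nat.mul_le_mul_right _ (Nat.pow_le_pow_left hk2 9)
      have e10 : 4 * k ^ 2 * (2 * (2 * k * k * m) + 1) =
          64 * k ^ 8 + 48 * k ^ 5 + 32 * k ^ 4 + 4 * k ^ 2 := by rw [hm]; ring
      omega

theorem ramsey_bound {l : ℕ} (hl : 1 ≤ l) : 2 * l + 3 + 176 * l ^ 3 ≤ (l + 1) ^ 17 := by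
  set k := l + 1 with hk
  have hk2 : 2 ≤ k := by omega
  have h1 : k ≤ k ^ 3 := Nat.le_self_pow (by norm_num) k
  have h3 : l ^ 3 ≤ k ^ 3 := Nat.pow_le_pow_left (by omega) 3
  have e9 : 2 ^ 14 * k ^ 3 ≤ k ^ 17 := by
    rw [show k ^ 17 = k ^ 14 * k ^ 3 by ring]
    exact Nat.mul_le_mul_right _ (Nat.pow_le_pow_left hk2 14)
  omega

/-- The spectral gap `1 / (l + 1)` of small sets halves the weight of a closed walk every
`2 * l * (l + 1)` steps. -/
theorem spectral_decay {l : ℕ} (hl : 1 ≤ l) (m : ℕ) :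
    (2 * (l : ℝ) - 1 / (l + 1)) ^ (2 * l * (l + 1) * m) ≤
      (2 * (l : ℝ)) ^ (2 * l * (l + 1) * m) * (1 / 2) ^ m := by
  have hl' : (1 : ℝ) ≤ l := by exact_mod_cast hl
  set n : ℕ := 2 * l * (l + 1) with hn
  have hn' : (n : ℝ) = 2 * l * (l + 1) := by rw [hn]; push_cast; ring
  have hn1 : (1 : ℝ) ≤ n := by rw [hn']; nlinarith
  have h1 : (1 - 1 / (n : ℝ)) ^ n ≤ 1 / 2 := by
    refine (Real.one_sub_div_pow_le_exp_neg hn1).trans ?_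
    rw [Real.exp_neg, inv_eq_one_div]
    have := Real.exp_one_gt_d9
    exact one_div_le_one_div_of_le two_pos (by linarith)
  have h2 : 2 * (l : ℝ) - 1 / (l + 1) = 2 * l * (1 - 1 / n) := by
    rw [hn']; field_simp
  rw [h2, mul_pow]
  refine mul_le_mul_of_nonneg_left ?_ (by positivity)
  rw [pow_mul]
  refine pow_le_pow_left₀ (pow_nonneg ?_ _) h1 m
  rw [sub_nonneg, div_le_one (by linarith)]
  exact hn1

variable {V E : Type*} [Fintype V] [NormedAddCommGroup E] [InnerProductSpace ℝ E]
  [FiniteDimensional ℝ E] {v : V → E} {l : ℕ}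

/-- No equiangular family has more than `r - 1 + ⌊(r - 1) / l⌋` members if the dimension `r` is
large. -/
theorem IsEquiangularFamily.false_of_card_eq (hv : IsEquiangularFamily (l : ℝ) v) (hl : 1 ≤ l)
    (hr : 2 ^ ((l + 1) ^ 17) ≤ finrank ℝ E)
    (hcard : Fintype.card V = finrank ℝ E + (finrank ℝ E - 1) / l) : False := by
  classical
  set r := finrank ℝ E
  set q := (r - 1) / l with hq
  have hlr : l + 1 ≤ r := by
    refine le_trans ?_ hr
    exact (Nat.le_self_pow (by norm_num) (l + 1)).trans Nat.lt_two_pow_self.le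
  have hq1 : 1 ≤ q := (Nat.one_le_div_iff hl).2 (by omega)
  have hqr : r ≤ l * (q + 1) := by
    have := Nat.lt_mul_div_succ (r - 1) hl
    rw [← hq] at this
    omega
  -- The number of dependencies exceeds `#V / (l + 1) - 1`.
  have hNlt : Fintype.card V < (l + 1) * (q + 1) := by
    rw [add_mul, one_mul]; omega
  obtain ⟨w, hw, hdeg⟩ := hv.exists_switching hl
    ((Nat.pow_le_pow_right two_pos (ramsey_bound hl)).trans (hr.trans (by omega)))
  have hD : ∀ i, (negGraph w).degree i ≤ 2 ^ (2 * l + 3 + 3 * l ^ 2) := fun i =>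
    (hdeg i _ fun j hj => by simpa using hj).le
  have hK := card_le_finrank_dependencySpace w
  have hqK : q ≤ finrank ℝ (dependencySpace w) := by omega
  by_cases hform : ∀ x : V → ℝ, x ⬝ᵥ (negGraph w).adjMatrix ℝ *ᵥ x ≤ l * (x ⬝ᵥ x)
  · have h1 := hw.finrank_dependencySpace_of_form_le hl hform (by omega)
    have h2 : (l + 1) * (q + 1) ≤ (l + 1) * (finrank ℝ (dependencySpace w) + 1) := by gcongr
    omega
  push Not at hform
  obtain ⟨z, hz⟩ := hform
  obtain ⟨m, hm⟩ : ∃ m, m = 4 * (l + 1) ^ 4 + 3 * (l + 1) + 2 := ⟨_, rfl⟩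
  have hm0 : 0 < m := by omega
  obtain ⟨d, hd1, hd2⟩ := hw.finrank_dependencySpace_of_large hl hD (p := 2 * l * (l + 1) * m)
    (by positivity) ⟨l * (l + 1) * m, by ring⟩ hz
  set B := 2 ^ (2 * l + 3 + 3 * l ^ 2) + 1 with hB
  have hBle := two_pow_degree_add_one_le hl
  rw [← hB] at hBle
  have hshort := short_walk_bound hBle hm
  have hball := (ball_bound hl hBle hm).trans hr
  set W := B ^ (2 * (2 * l * (l + 1) * m) + 1) with hW
  have hl' : (1 : ℝ) ≤ l := by exact_mod_cast hl
  set N : ℝ := (Fintype.card V : ℝ) with hN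
  have hN0 : 0 < N := by
    have : 0 < Fintype.card V := by omega
    rw [hN]; exact_mod_cast this
  -- `Y * (1 / 2) ^ m` bounds the weight of the walks on at most `l + 1` vertices, per vertex.
  set Y : ℝ := ((B ^ ((l + 1) * (l + 1)) * (l + 1) : ℕ) : ℝ) with hY
  have hY0 : 0 ≤ Y := Nat.cast_nonneg _
  set c : ℝ := (2 * (l : ℝ)) ^ (2 * l * (l + 1) * m) with hc
  have hc0 : 0 < c := by positivity
  -- Dividing the multiplicity bound by `(2 * l) ^ p`.
  have hd3 : ((l : ℝ) + 2) * d ≤ N + (l + 2) * (N * Y * (1 / 2) ^ m) := by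
    have h1 := spectral_decay hl m
    rw [← hc] at h1
    have h2 : ((l : ℝ) + 2) * (d * c) ≤ N * c + (l + 2) * (N * Y * (c * (1 / 2) ^ m)) := by
      refine hd2.trans (add_le_add le_rfl (mul_le_mul_of_nonneg_left ?_ (by positivity)))
      have h3 : N * ((2 ^ (2 * l + 3 + 3 * l ^ 2) : ℕ) + 1 : ℝ) ^ ((l + 1) * (l + 1)) *
          ((l : ℝ) + 1) = N * Y := by
        rw [hY, hB]; push_cast; ring
      rw [h3]
      exact mul_le_mul_of_nonneg_left h1 (by positivity)
    refine le_of_mul_le_mul_right ?_ hc0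
    calc ((l : ℝ) + 2) * d * c = ((l : ℝ) + 2) * (d * c) := by ring
      _ ≤ _ := h2
      _ = _ := by ring
  have hd4 : (q : ℝ) ≤ d + W + 1 := by exact_mod_cast hqK.trans hd1
  have hN4 : N < (l + 1) * (q + 1) := by rw [hN]; exact_mod_cast hNlt
  have hsh : 2 * (((l : ℝ) + 1) * (l + 2)) * Y * (1 / 2) ^ m ≤ 1 := by
    rw [one_div, inv_pow, ← div_eq_mul_inv, div_le_one (by positivity)]
    rw [hY]
    exact_mod_cast hshort
  have hba : 2 * (((l : ℝ) + 1) * (l + 2)) * (W + 2) ≤ N := by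
    have : 2 * ((l + 1) * (l + 2)) * (W + 2) ≤ Fintype.card V := hball.trans (by omega)
    rw [hN]; exact_mod_cast this
  have h5 : N < (l + 1) * (d + W + 2) :=
    hN4.trans_le (mul_le_mul_of_nonneg_left (by linarith) (by positivity))
  have h6 : (l + 2) * N < (l + 2) * ((l + 1) * (d + W + 2)) :=
    mul_lt_mul_of_pos_left h5 (by positivity)
  have h7 := mul_le_mul_of_nonneg_left hd3 (by positivity : (0 : ℝ) ≤ l + 1)
  have h8 := mul_le_mul_of_nonneg_left hsh hN0.le
  nlinarith

end UpperBound

/-! ### Families of vectors and families of lines -/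

section Lines

open Module
open scoped InnerProductSpace

variable {V E : Type*} [NormedAddCommGroup E] [InnerProductSpace ℝ E]

theorem one_div_two_mul_add_one_mem {lam : ℝ} (hlam : 0 < lam) :
    0 < 1 / (2 * lam + 1) ∧ 1 / (2 * lam + 1) < 1 :=
  ⟨by positivity, (div_lt_one (by positivity)).2 (by linarith)⟩

/-- Scaled direction vectors of equiangular lines form an equiangular family. -/
theorem IsEquiangular.isEquiangularFamily {lam : ℝ} (hlam : 0 < lam)
    {L : Set (Projectivization ℝ E)} (hL : IsEquiangular (1 / (2 * lam + 1)) L) :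
    IsEquiangularFamily lam fun i : L => (√(lam + 1 / 2) / ‖i.1.rep‖) • i.1.rep := by
  have hsq : √(lam + 1 / 2) * √(lam + 1 / 2) = lam + 1 / 2 :=
    Real.mul_self_sqrt (by linarith)
  obtain ⟨hα0, hα1⟩ := one_div_two_mul_add_one_mem hlam
  have hinner : ∀ x y : E, x ≠ 0 → y ≠ 0 →
      ⟪(√(lam + 1 / 2) / ‖x‖) • x, (√(lam + 1 / 2) / ‖y‖) • y⟫_ℝ =
        (lam + 1 / 2) * Real.cos (InnerProductGeometry.angle x y) := by
    intro x y hx hy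
    have hx' := norm_ne_zero_iff.2 hx
    have hy' := norm_ne_zero_iff.2 hy
    rw [InnerProductGeometry.cos_angle, inner_smul_left, inner_smul_right, conj_trivial]
    generalize √(lam + 1 / 2) = c at hsq
    rw [← hsq]
    field_simp
  refine ⟨fun i => ?_, fun i j hij => ?_⟩
  · rw [hinner _ _ i.1.rep_nonzero i.1.rep_nonzero,
      InnerProductGeometry.angle_self i.1.rep_nonzero, Real.cos_zero, mul_one]
  · rw [hinner _ _ i.1.rep_nonzero j.1.rep_nonzero]
    have h : lineAngle i.1 j.1 = _ := hL i.2 j.2 fun h => hij (Subtype.ext h)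
    rw [lineAngle] at h
    have hα : (lam + 1 / 2) * (1 / (2 * lam + 1)) = 1 / 2 := by field_simp
    rcases min_choice (InnerProductGeometry.angle i.1.rep j.1.rep)
      (Real.pi - InnerProductGeometry.angle i.1.rep j.1.rep) with h1 | h1
    · left
      rw [h1] at h
      rw [h, Real.cos_arccos (by linarith) hα1.le, hα]
    · right
      rw [h1] at h
      have h2 : InnerProductGeometry.angle i.1.rep j.1.rep =
          Real.pi - Real.arccos (1 / (2 * lam + 1)) := by linarith
      rw [h2, Real.cos_pi_sub, Real.cos_arccos (by linarith) hα1.le, mul_neg, hα]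

theorem IsEquiangularFamily.ne_zero {lam : ℝ} (hlam : 0 < lam) {v : V → E}
    (hv : IsEquiangularFamily lam v) (i : V) : v i ≠ 0 := by
  intro h
  have := hv.inner_self i
  rw [h, inner_zero_left] at this
  linarith

theorem IsEquiangularFamily.lineAngle_eq {lam : ℝ} (hlam : 0 < lam) {v : V → E}
    (hv : IsEquiangularFamily lam v) {i j : V} (hij : i ≠ j) :
    lineAngle (Projectivization.mk ℝ (v i) (hv.ne_zero hlam i))
      (Projectivization.mk ℝ (v j) (hv.ne_zero hlam j)) = Real.arccos (1 / (2 * lam + 1)) := by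
  obtain ⟨hα0, hα1⟩ := one_div_two_mul_add_one_mem hlam
  rw [lineAngle_mk, InnerProductGeometry.angle]
  have hnorm : ∀ i, ‖v i‖ = √(lam + 1 / 2) := fun i => by
    rw [norm_eq_sqrt_real_inner, hv.inner_self]
  rw [hnorm, hnorm, Real.mul_self_sqrt (by linarith)]
  have hle : Real.arccos (1 / (2 * lam + 1)) ≤ Real.pi / 2 := Real.arccos_le_pi_div_two.2 hα0.le
  rcases hv.inner_of_ne i j hij with h | h
  · rw [h, show 1 / 2 / (lam + 1 / 2) = 1 / (2 * lam + 1) by field_simp]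
    exact min_eq_left (by linarith)
  · rw [h, show -(1 / 2) / (lam + 1 / 2) = -(1 / (2 * lam + 1)) by field_simp, Real.arccos_neg,
      sub_sub_cancel]
    exact min_eq_right (by linarith)

theorem IsEquiangularFamily.exists_lines [Fintype V] {lam : ℝ} (hlam : 0 < lam) {v : V → E}
    (hv : IsEquiangularFamily lam v) :
    ∃ L : Set (Projectivization ℝ E), IsEquiangular (1 / (2 * lam + 1)) L ∧
      L.encard = Fintype.card V := by
  obtain ⟨hα0, hα1⟩ := one_div_two_mul_add_one_mem hlam
  set f : V → Projectivization ℝ E := fun i => Projectivization.mk ℝ (v i) (hv.ne_zero hlam i)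
    with hf
  have hinj : Function.Injective f := by
    intro i j hij
    by_contra hne
    have h1 := hv.lineAngle_eq hlam hne
    change lineAngle (f i) (f j) = _ at h1
    rw [hij, hf, lineAngle_mk, InnerProductGeometry.angle_self (hv.ne_zero hlam j), sub_zero,
      min_eq_left Real.pi_pos.le] at h1
    exact absurd h1 (Real.arccos_pos.2 hα1).ne
  refine ⟨Set.range f, ?_, ?_⟩
  · rintro _ ⟨i, rfl⟩ _ ⟨j, rfl⟩ hij
    exact hv.lineAngle_eq hlam fun h => hij (congrArg f h)
  · rw [← Set.image_univ, hinj.encard_image, Set.encard_univ, ENat.card_eq_coe_fintype_card]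

/-- An equiangular family can be moved isometrically to any Euclidean space whose dimension is at
least that of its span. -/
theorem IsEquiangularFamily.exists_of_span_le {lam : ℝ} {v : V → E}
    (hv : IsEquiangularFamily lam v) (S : Submodule ℝ E) [FiniteDimensional ℝ S]
    (hS : ∀ i, v i ∈ S) {r : ℕ} (hr : finrank ℝ S ≤ r) :
    ∃ w : V → EuclideanSpace ℝ (Fin r), IsEquiangularFamily lam w := by
  have hon : Orthonormal ℝ fun i : Fin (finrank ℝ S) =>
      EuclideanSpace.basisFun (Fin r) ℝ (Fin.castLE hr i) :=
    (EuclideanSpace.basisFun (Fin r) ℝ).orthonormal.comp _ (Fin.castLE_injective hr)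
  set b := stdOrthonormalBasis ℝ S
  let φ := b.toBasis.constr ℝ fun i : Fin (finrank ℝ S) =>
    EuclideanSpace.basisFun (Fin r) ℝ (Fin.castLE hr i)
  have hφ : Orthonormal ℝ (φ ∘ b.toBasis) := by
    convert hon using 1
    funext i
    exact b.toBasis.constr_basis ℝ _ i
  let ψ : S →ₗᵢ[ℝ] EuclideanSpace ℝ (Fin r) :=
    φ.isometryOfOrthonormal (v := b.toBasis) (by simp) hφ
  exact ⟨fun i => ψ ⟨v i, hS i⟩, fun i => by rw [ψ.inner_map_map]; exact hv.inner_self i,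
    fun i j hij => by rw [ψ.inner_map_map]; exact hv.inner_of_ne i j hij⟩

end Lines

/-! ### The construction -/

section Construction

open Module
open scoped InnerProductSpace

/-- The vectors of the extremal family. All share one coordinate; on top of it there are `t`
regular simplices with `l + 1` vertices each, centred at the origin, and `s` further orthogonal
vectors. -/
noncomputable def simplexFamily (l t s : ℕ) (i : (Fin t × Fin (l + 1)) ⊕ Fin s) :
    EuclideanSpace ℝ (Option ((Fin t × Fin (l + 1)) ⊕ Fin s)) :=
  WithLp.toLp 2 fun o =>
    match i, o with
    | _, none => √(1 / 2)
    | .inl a, some (.inl b) =>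
      if a.1 = b.1 then √(l + 1) * ((if a.2 = b.2 then 1 else 0) - 1 / (l + 1)) else 0
    | .inr a, some (.inr b) => if a = b then √l else 0
    | _, _ => 0

theorem isEquiangularFamily_simplexFamily (l t s : ℕ) :
    IsEquiangularFamily (l : ℝ) (simplexFamily l t s) := by
  have hl1 : √(l + 1 : ℝ) * √(l + 1) = l + 1 := Real.mul_self_sqrt (by positivity)
  have hinner : ∀ i j, ⟪simplexFamily l t s i, simplexFamily l t s j⟫_ℝ = 1 / 2 +
      match i, j with
      | .inl a, .inl b => if a.1 = b.1 then (l + 1) * (if a.2 = b.2 then 1 else 0) - 1 else (0 : ℝ)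
      | .inr a, .inr b => if a = b then (l : ℝ) else 0
      | _, _ => 0 := by
    intro i j
    rw [PiLp.inner_apply, Fintype.sum_option, Fintype.sum_sum_type, Fintype.sum_prod_type]
    rcases i with ⟨a, b⟩ | a <;> rcases j with ⟨a', b'⟩ | a'
    · have hsum : ∑ c, (√(l + 1 : ℝ) * ((if b' = c then 1 else 0) - 1 / (l + 1))) *
          (√(l + 1) * ((if b = c then 1 else 0) - 1 / (l + 1))) =
          (l + 1) * (if b = b' then 1 else 0) - 1 := by
        have e1 : ∀ c : Fin (l + 1), (√(l + 1 : ℝ) * ((if b' = c then 1 else 0) - 1 / (l + 1))) *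
            (√(l + 1) * ((if b = c then 1 else 0) - 1 / (l + 1))) =
            (l + 1) * (if b' = c then if b = c then 1 else 0 else 0) -
              (if b' = c then 1 else 0) - (if b = c then 1 else 0) + 1 / (l + 1) := by
          intro c
          rw [mul_mul_mul_comm, hl1]
          split_ifs <;> field_simp <;> ring
        simp only [e1, Finset.sum_add_distrib, Finset.sum_sub_distrib, ← Finset.mul_sum,
          Finset.sum_ite_eq, Finset.mem_univ, if_true, Finset.sum_const, Finset.card_univ,
          Fintype.card_fin, nsmul_eq_mul]
        push_cast
        field_simp
        ring
      have hnone : ⟪(simplexFamily l t s (.inl (a, b))).ofLp none,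
          (simplexFamily l t s (.inl (a', b'))).ofLp none⟫_ℝ = 1 / 2 := by
        simp [simplexFamily]
      rw [hnone]
      congr 1
      by_cases ha : a = a'
      · subst ha
        rw [Finset.sum_eq_single a (fun c _ hc => by simp [simplexFamily, hc.symm]) (by simp)]
        simpa [simplexFamily] using hsum
      · simp only [if_neg ha, simplexFamily]
        rw [Finset.sum_eq_zero fun c _ => ?_]
        · simp
        · refine Finset.sum_eq_zero fun d _ => ?_
          by_cases hc : a = c
          · simp [show a' ≠ c from fun h => ha (hc.trans h.symm)]
          · simp [hc]
    · simp [simplexFamily]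
    · simp [simplexFamily]
    · by_cases ha : a = a'
      · simp [simplexFamily, ha]
      · simp [simplexFamily, ha, Ne.symm ha]
  refine ⟨fun i => ?_, fun i j hij => ?_⟩
  · rw [hinner]
    rcases i with ⟨a, b⟩ | a <;> simp <;> ring
  · rw [hinner]
    rcases i with ⟨a, b⟩ | a <;> rcases j with ⟨a', b'⟩ | a'
    · by_cases ha : a = a'
      · have hb : b ≠ b' := fun hb => hij (by rw [ha, hb])
        right; simp [ha, hb]; norm_num
      · left; simp [ha]
    · left; simp
    · left; simp
    · have ha : a ≠ a' := fun ha => hij (by rw [ha])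
      left; simp [ha]

theorem exists_equiangularFamily_of_dim (l t s r : ℕ) (hr : t * l + s + 1 ≤ r) :
    ∃ w : (Fin t × Fin (l + 1)) ⊕ Fin s → EuclideanSpace ℝ (Fin r),
      IsEquiangularFamily (l : ℝ) w := by
  -- The coordinates of each simplex sum to zero.
  let φ : EuclideanSpace ℝ (Option ((Fin t × Fin (l + 1)) ⊕ Fin s)) →ₗ[ℝ] (Fin t → ℝ) :=
    { toFun := fun x a => ∑ b, x.ofLp (some (.inl (a, b)))
      map_add' := fun x y => by ext; simp [Finset.sum_add_distrib]
      map_smul' := fun c x => by ext; simp [Finset.mul_sum] }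
  have hφ : Function.Surjective φ := by
    intro y
    refine ⟨WithLp.toLp 2 fun o => match o with
      | some (.inl (a, b)) => if b = 0 then y a else 0
      | _ => 0, ?_⟩
    funext a
    simp [φ]
  refine (isEquiangularFamily_simplexFamily l t s).exists_of_span_le (LinearMap.ker φ)
    (fun i => ?_) ?_
  · rw [LinearMap.mem_ker]
    funext a
    rcases i with ⟨a', b'⟩ | a'
    · by_cases ha : a' = a
      · simp only [φ, simplexFamily, LinearMap.coe_mk, AddHom.coe_mk, ha, if_true, ← Finset.mul_sum,
          Finset.sum_sub_distrib, Pi.zero_apply]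
        simp
        right
        field_simp
        simp
      · simp [φ, simplexFamily, ha]
    · simp [φ, simplexFamily]
  · have h1 := LinearMap.finrank_range_add_finrank_ker φ
    rw [LinearMap.range_eq_top.2 hφ, finrank_top, finrank_euclideanSpace] at h1
    simp only [finrank_fintype_fun_eq_card, Fintype.card_fin, Fintype.card_option,
      Fintype.card_sum, Fintype.card_prod] at h1
    have : t * (l + 1) = t * l + t := by ring
    omega

end Construction

theorem corollary1p3 :
    ∃ C : ℕ, ∀ k : ℕ, 2 ≤ k → ∀ r : ℕ, 2 ^ (k ^ C) ≤ r →
      IsGreatest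
        {n : ℕ∞ | ∃ L : Set (Projectivization ℝ (EuclideanSpace ℝ (Fin r))),
          IsEquiangular (1 / (2 * (k : ℝ) - 1)) L ∧ L.encard = n}
        ((r - 1 + (r - 1) / (k - 1) : ℕ) : ℕ∞) := by
  refine ⟨17, fun k hk r hr => ?_⟩
  obtain ⟨l, rfl⟩ : ∃ l, k = l + 1 := ⟨k - 1, by omega⟩
  have hl : 1 ≤ l := by omega
  have hlpos : (0 : ℝ) < l := by exact_mod_cast hl
  have hα : 1 / (2 * ((l + 1 : ℕ) : ℝ) - 1) = 1 / (2 * (l : ℝ) + 1) := by push_cast; ring_nf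
  have hr1 : 1 ≤ r := Nat.one_le_two_pow.trans hr
  rw [hα, Nat.add_sub_cancel]
  set q := (r - 1) / l with hq
  constructor
  · have hql : q * l ≤ r - 1 := Nat.div_mul_le_self _ _
    obtain ⟨w, hw⟩ := exists_equiangularFamily_of_dim l q (r - 1 - q * l) r (by omega)
    obtain ⟨L, hL, hLc⟩ := hw.exists_lines hlpos
    refine ⟨L, hL, hLc.trans ?_⟩
    congr 1
    simp only [Fintype.card_sum, Fintype.card_prod, Fintype.card_fin]
    have : q * (l + 1) = q * l + q := by ring
    omega
  · rintro n ⟨L, hL, rfl⟩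
    by_contra hlt
    have h1 : ((r - 1 + q + 1 : ℕ) : ℕ∞) ≤ L.encard := by
      have := Order.add_one_le_of_lt (not_le.1 hlt)
      exact_mod_cast this
    obtain ⟨T, hTL, hT⟩ := Set.exists_subset_encard_eq h1
    have hfin : T.Finite := Set.finite_of_encard_eq_coe hT
    have := hfin.fintype
    have hTc : Fintype.card T = r + q := by
      rw [Set.encard_eq_coe_toFinset_card, Set.toFinset_card] at hT
      have hT' : Fintype.card T = r - 1 + q + 1 := by exact_mod_cast hT
      omega
    have hTL' : IsEquiangular (1 / (2 * (l : ℝ) + 1)) T := hL.mono hTL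
    exact (hTL'.isEquiangularFamily hlpos).false_of_card_eq hl
      (by simpa using hr) (by simpa using hTc)
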